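/- **Setting.** A (fully interactive) protocol in the local model consists of $n$ agents $P_1,\dots,P_n$, where $P_i$ holds a single input $y_i$ from a data domain $X$, and a referee without input. All parties are randomized, with independent coins. The agents communicate only with the referee: in each step the referee selects an agent and sends it a message, which may depend on the referee's coins and on all answers received so far, and that agent answers with one message, which depends on its input, its coins and the messages it has seen. After the agents have sent a total of $r$ messages, the referee writes an output; $r$ is the number of messages sent by the agents to the referee. The protocol is $\varepsilon$-differentially private if for every agent $P_i$, every randomized interactive adversary $A$ that talks to $P_i$ in place of all other parties (sending it arbitrary messages), all $x,x'\in X$, and every measurable event $T$, the output $A_{P_i}(x)$ of $A$ after its interaction with $P_i$ on input $x$ satisfies $\Pr[A_{P_i}(x)\in T]\le e^{\varepsilon}\,\Pr[A_{P_i}(x')\in T]$. The protocol solves the selection problem over $\{0,1\}^d$ with error $\alpha$ if $X=\{0,1\}^d$, its output is a coordinate $j\in\{1,\dots,d\}$, and for every probability distribution $\mathcal D$ on $\{0,1\}^d$ with mean $\mu=(\mu_1,\dots,\mu_d)$, when the inputs $Y=(y_1,\dots,y_n)$ are i.i.d. samples from $\mathcal D$, one has $\mathbb E[\mu_j]\ge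 \max_k\mu_k-\alpha$, where the expectation is over $Y$ and the coins of all parties. **Theorem.** There is an absolute constant $c>0$ such that for every $d\ge 2$ and every $n$, every $1$-differentially private protocol in the local model with $n$ agents that solves the selection problem over $\{0,1\}^d$ with error $\alpha=1/10$ has at least $c\,d^{1/3}$ messages sent by the agents to the referee. -/

import Mathlib

open MeasureTheory

universe u v w

/-- An agent of an interactive protocol: an interactive randomized functionality with input in `X`,
receiving messages in `Q` and answering each of them by a message in `M`.
`start x` is the law of the initial state, which holds the input `x` and all the random coins of
the agent; afterwards each answer, and the new state, is a function of the current state (input,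
coins, messages seen so far) and the message just received. -/
structure Agent (X : Type v) (Q M : Type u) [MeasurableSpace Q] [MeasurableSpace M] where
  State : Type u
  [measurableSpace : MeasurableSpace State]
  start : X → Measure State
  [isProbabilityMeasure : ∀ x, IsProbabilityMeasure (start x)]
  respond : State × Q → M × State
  measurable_respond : Measurable respond

/-- The asking side of an interaction: a randomized functionality without input that sends
queries in `Q`, receives an answer in `M` to each of them, and in the end writes an output in `O`.
`start` is the law of the initial state, which holds all the random coins. -/
structure Interrogator (Q M : Type u) (O : Type w)
    [MeasurableSpace Q] [MeasurableSpace M] [MeasurableSpace O] where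
  State : Type u
  [measurableSpace : MeasurableSpace State]
  start : Measure State
  [isProbabilityMeasure : IsProbabilityMeasure start]
  query : State → Q
  measurable_query : Measurable query
  receive : State × M → State
  measurable_receive : Measurable receive
  output : State → O
  measurable_output : Measurable output

attribute [instance] Agent.measurableSpace Agent.isProbabilityMeasure
  Interrogator.measurableSpace Interrogator.isProbabilityMeasure

/-- Two laws are `(ε, δ)`-close. -/
def DPClose {Ω : Type*} [MeasurableSpace Ω] (ε δ : ℝ) (μ ν : Measure Ω) : Prop :=
  ∀ T : Set Ω, MeasurableSet T →
    μ T ≤ ENNReal.ofReal (Real.exp ε) * ν T + ENNReal.ofReal δ ∧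
    ν T ≤ ENNReal.ofReal (Real.exp ε) * μ T + ENNReal.ofReal δ

noncomputable section

namespace Agent

variable {X : Type v} {Q M : Type u} {O : Type w}
  [MeasurableSpace Q] [MeasurableSpace M] [MeasurableSpace O]

/-- One exchange between an adversary `A` and the agent `P`: `A` sends a message, `P` answers. -/
def exchange (P : Agent X Q M) (A : Interrogator Q M O) (s : A.State × P.State) :
    A.State × P.State :=
  let answer := P.respond (s.2, A.query s.1)
  (A.receive (s.1, answer.1), answer.2)

/-- The law of the output of the adversary `A` that halts after `N` exchanges with the agent `P`
whose input is `x`. -/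
def adversaryOutput (P : Agent X Q M) (A : Interrogator Q M O) (N : ℕ) (x : X) : Measure O :=
  (A.start.prod (P.start x)).map fun s => A.output ((P.exchange A)^[N] s).1

lemma measurable_exchange (P : Agent X Q M) (A : Interrogator Q M O) :
    Measurable (P.exchange A) := by
  have h : Measurable fun s : A.State × P.State => P.respond (s.2, A.query s.1) :=
    P.measurable_respond.comp (measurable_snd.prodMk (A.measurable_query.comp measurable_fst))
  exact (A.measurable_receive.comp (measurable_fst.prodMk (measurable_fst.comp h))).prodMk
    (measurable_snd.comp h)

instance (P : Agent X Q M) (A : Interrogator Q M O) (N : ℕ) (x : X) :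
    IsProbabilityMeasure (P.adversaryOutput A N x) :=
  Measure.isProbabilityMeasure_map
    (A.measurable_output.comp
      (measurable_fst.comp ((P.measurable_exchange A).iterate N))).aemeasurable

end Agent

/-- A (fully interactive) protocol in the local model: `n` agents, each holding one input in `X`,
and a referee without input. The referee repeatedly selects an agent and sends it a message, and
that agent answers by one message; the selected agent and the message sent to it may depend on the
coins of the referee and on all previous answers. The agents send `messages` messages in total
(padded to the worst case); then the referee writes the output in `O`. -/
structure LocalProtocol (X : Type v) (Q M : Type u) (O : Type w)
    [MeasurableSpace Q] [MeasurableSpace M] [MeasurableSpace O] (n : ℕ) where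
  agent : Fin n → Agent X Q M
  referee : Interrogator (Fin n × Q) M O
  messages : ℕ

namespace LocalProtocol

variable {X : Type v} {Q M : Type u} {O : Type w}
  [MeasurableSpace Q] [MeasurableSpace M] [MeasurableSpace O] {n : ℕ}

/-- The joint state of the referee and all agents. -/
abbrev Config (P : LocalProtocol X Q M O n) : Type u :=
  P.referee.State × (∀ i, (P.agent i).State)

/-- One exchange: the referee sends a message to an agent, which answers. -/
def step (P : LocalProtocol X Q M O n) (s : P.Config) : P.Config :=
  let i := (P.referee.query s.1).1
  let answer := (P.agent i).respond (s.2 i, (P.referee.query s.1).2)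
  (P.referee.receive (s.1, answer.1), Function.update s.2 i answer.2)

/-- The law of the output of the referee when the inputs of the agents are `z`; the coins of the
parties are independent. -/
def outcome (P : LocalProtocol X Q M O n) (z : Fin n → X) : Measure O :=
  (P.referee.start.prod (Measure.pi fun i => (P.agent i).start (z i))).map
    fun s => P.referee.output (P.step^[P.messages] s).1

/-- `(ε, δ)`-differential privacy against arbitrary (malicious) adversaries that control everybody
but one agent. As every agent holds a single input, any two inputs are neighboring. -/
def IsDP (P : LocalProtocol X Q M O n) (ε δ : ℝ) : Prop :=
  ∀ (i : Fin n) (Out : Type u) [MeasurableSpace Out] (A : Interrogator Q M Out) (N : ℕ) (x x' : X),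
    DPClose ε δ ((P.agent i).adversaryOutput A N x) ((P.agent i).adversaryOutput A N x')

lemma measurable_step (P : LocalProtocol X Q M O n) : Measurable P.step := by
  have hq : Measurable fun s : P.Config => P.referee.query s.1 :=
    P.referee.measurable_query.comp measurable_fst
  have key : ∀ i : Fin n, Measurable fun s : P.Config =>
      (P.referee.receive (s.1, ((P.agent i).respond (s.2 i, (P.referee.query s.1).2)).1),
        Function.update s.2 i ((P.agent i).respond (s.2 i, (P.referee.query s.1).2)).2) := by
    intro i
    have h : Measurable fun s : P.Config =>
        (P.agent i).respond (s.2 i, (P.referee.query s.1).2) :=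
      (P.agent i).measurable_respond.comp
        (((measurable_pi_apply i).comp measurable_snd).prodMk (measurable_snd.comp hq))
    refine (P.referee.measurable_receive.comp
      (measurable_fst.prodMk (measurable_fst.comp h))).prodMk ?_
    exact measurable_update'.comp (measurable_snd.prodMk (measurable_snd.comp h))
  exact measurable_from_prod_countable_right (f := fun p : Fin n × P.Config =>
      (P.referee.receive (p.2.1, ((P.agent p.1).respond (p.2.2 p.1, (P.referee.query p.2.1).2)).1),
        Function.update p.2.2 p.1
          ((P.agent p.1).respond (p.2.2 p.1, (P.referee.query p.2.1).2)).2)) key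
    |>.comp ((measurable_fst.comp hq).prodMk measurable_id)

instance (P : LocalProtocol X Q M O n) (z : Fin n → X) : IsProbabilityMeasure (P.outcome z) :=
  Measure.isProbabilityMeasure_map
    (P.referee.measurable_output.comp
      (measurable_fst.comp (P.measurable_step.iterate P.messages))).aemeasurable

end LocalProtocol

/-- The `k`-th coordinate of the mean of a distribution on `{0,1}^d`. -/
def coordMean {d : ℕ} (D : Measure (Fin d → Bool)) (k : Fin d) : ℝ :=
  D.real {y | y k = true}

/-- The protocol solves the selection problem over `{0,1}^d` with error `α`: for every distribution
`D`, if the inputs `Y` of the agents are i.i.d. samples from `D`, then the output `j` satisfies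
`E[μ_j] ≥ max_k μ_k - α`, where `μ` is the mean of `D` and the expectation is over `Y` and the
coins of all parties. -/
def LocalProtocol.SolvesSelection {d n : ℕ} {Q M : Type u} [MeasurableSpace Q] [MeasurableSpace M]
    (P : LocalProtocol (Fin d → Bool) Q M (Fin d) n) (α : ℝ) : Prop :=
  ∀ D : Measure (Fin d → Bool), IsProbabilityMeasure D → ∀ k : Fin d,
    coordMean D k - α ≤
      ∫ Y : Fin n → Fin d → Bool, (∫ j, coordMean D j ∂(P.outcome Y)) ∂(Measure.pi fun _ => D)

end

/-! The hard inputs are, for each `k`, i.i.d. uniform points of the cube subject to bit `k` being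
set (`cubeTilt k`). Coordinate `k` then has mean 1 and every other coordinate has mean 1/2, so error
`α` forces the output to differ from `k` with probability at most `2α`. The proof shows that, summed
over `k`, these failure probabilities are at least `d - 1 - e^ε √d r`, where `r` is the number of
messages. Hence `r` is at least of order `√d`, which is more than `d^(1/3)`.

Fix the initial state of the referee and let all inputs be uniform. The `k`-th hard distribution has
density `∏ i, (1 + χ_k(y_i))` with respect to this law, where `χ_k` is the sign of bit `k`. Given
the transcript of the referee the agents remain independent (`condIndepGiven_publicInfo`), so
against a function of the transcript each `χ_k(y_i)` may be replaced by its posterior mean `b_{ik}`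
(`integral_prod_one_add_replace`). As `∏ i, (1 + b_{ik}) ≥ 1 - ∑ i, |b_{ik}|`, it remains to bound
`∑ i, ∑ k, E|b_{ik}|`.

For one agent, `∑ k, E|b_{ik}|` is the expectation of `∑ k, c_k χ_k(y_i)` with signs `c_k` that are
functions of the transcript. Only transcripts in which the agent is asked contribute. There, privacy
allows `y_i` to be replaced by a fresh uniform point at the cost of a factor `e^ε`, and
orthogonality of the `χ_k` bounds the mean absolute value by `√d`. So the sum is at most `e^ε √d`
times the probability that agent `i` is asked (`sum_integral_abs_posterior_le`). At most `r` agents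
are asked, so the total over `i` is at most `e^ε √d r`, however many agents there are.

Privacy is assumed against an adversary facing a single agent. To use it for transcripts, the rest
of the protocol with its coins fixed is turned into one such adversary (`worldAdversary`), and the
referee is made to record its history (`record`). -/

/-! ### Signs on the cube and elementary inequalities. -/

/-- The `k`-th coordinate of a point of the discrete cube, as a sign. -/
noncomputable def cubeSign {d : ℕ} (k : Fin d) (x : Fin d → Bool) : ℝ := if x k then 1 else -1

lemma abs_cubeSign {d : ℕ} (k : Fin d) (x : Fin d → Bool) : |cubeSign k x| = 1 := by
  unfold cubeSign; split_ifs <;> simp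

lemma cubeSign_mul_self {d : ℕ} (k : Fin d) (x : Fin d → Bool) :
    cubeSign k x * cubeSign k x = 1 := by
  unfold cubeSign; split_ifs <;> simp

lemma one_add_cubeSign_nonneg {d : ℕ} (k : Fin d) (x : Fin d → Bool) : 0 ≤ 1 + cubeSign k x := by
  unfold cubeSign; split_ifs <;> norm_num

lemma sum_eq_zero_of_flip {d : ℕ} (k : Fin d) (f : (Fin d → Bool) → ℝ)
    (hf : ∀ x, f (Function.update x k (!x k)) = -f x) : ∑ x, f x = 0 := by
  have hinv : Function.Involutive fun x : Fin d → Bool => Function.update x k (!x k) := by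
    intro x; simp
  have h : ∑ x, f (Function.update x k (!x k)) = ∑ x, f x :=
    Equiv.sum_comp hinv.toPerm f
  simp only [hf, Finset.sum_neg_distrib] at h
  linarith

lemma cubeSign_flip_self {d : ℕ} (k : Fin d) (x : Fin d → Bool) :
    cubeSign k (Function.update x k (!x k)) = -cubeSign k x := by
  unfold cubeSign; cases h : x k <;> simp

lemma cubeSign_flip_of_ne {d : ℕ} {k l : Fin d} (h : l ≠ k) (x : Fin d → Bool) :
    cubeSign l (Function.update x k (!x k)) = cubeSign l x := by
  unfold cubeSign; simp [h]

lemma sum_cubeSign {d : ℕ} (k : Fin d) : ∑ x, cubeSign k x = 0 :=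
  sum_eq_zero_of_flip k _ (cubeSign_flip_self k)

lemma sum_cubeSign_mul {d : ℕ} (k l : Fin d) :
    ∑ x, cubeSign k x * cubeSign l x = if k = l then (2 : ℝ) ^ d else 0 := by
  split_ifs with h
  · subst h; simp [cubeSign_mul_self]
  · refine sum_eq_zero_of_flip k _ fun x => ?_
    rw [cubeSign_flip_self, cubeSign_flip_of_ne (Ne.symm h), neg_mul]

/-- By orthogonality of the signs the second moment is exactly `d`; Cauchy–Schwarz does the rest.
This is the source of the `√d` in the bound. -/
lemma sum_abs_signed_cubeSign_le {d : ℕ} (c : Fin d → ℝ) (hc : ∀ k, |c k| = 1) :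
    ∑ x, |∑ k, c k * cubeSign k x| ≤ 2 ^ d * √d := by
  have hsq : ∑ x, |∑ k, c k * cubeSign k x| ^ 2 = 2 ^ d * d := by
    have hcc : ∀ k, c k * c k = 1 := fun k => by
      rw [← abs_mul_abs_self, hc, one_mul]
    calc ∑ x, |∑ k, c k * cubeSign k x| ^ 2
        = ∑ x, ∑ k, ∑ l, c k * c l * (cubeSign k x * cubeSign l x) := by
          refine Finset.sum_congr rfl fun x _ => ?_
          rw [sq_abs, sq, Finset.sum_mul_sum]
          exact Finset.sum_congr rfl fun k _ => Finset.sum_congr rfl fun l _ => by ring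
      _ = ∑ k, ∑ l, c k * c l * ∑ x, cubeSign k x * cubeSign l x := by
          rw [Finset.sum_comm]
          refine Finset.sum_congr rfl fun k _ => ?_
          rw [Finset.sum_comm]
          exact Finset.sum_congr rfl fun l _ => (Finset.mul_sum ..).symm
      _ = 2 ^ d * d := by
          simp [sum_cubeSign_mul, hcc, mul_comm]
  have hcs := sq_sum_le_card_mul_sum_sq (s := (Finset.univ : Finset (Fin d → Bool)))
    (f := fun x => |∑ k, c k * cubeSign k x|)
  rw [hsq] at hcs
  refine abs_le_of_sq_le_sq' ?_ (by positivity) |>.2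
  refine hcs.trans (le_of_eq ?_)
  rw [mul_pow, Real.sq_sqrt (Nat.cast_nonneg d)]
  simp
  ring

lemma one_sub_sum_abs_le_prod {ι : Type*} (s : Finset ι) (b : ι → ℝ) (hb : ∀ i, |b i| ≤ 1) :
    1 - ∑ i ∈ s, |b i| ≤ ∏ i ∈ s, (1 + b i) := by
  classical
  induction s using Finset.induction_on with
  | empty => simp
  | insert i s hi ih =>
    rw [Finset.sum_insert hi, Finset.prod_insert hi]
    have h0 : 0 ≤ ∏ j ∈ s, (1 + b j) :=
      Finset.prod_nonneg fun j _ => by linarith [(abs_le.1 (hb j)).1]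
    have h1 : 0 ≤ ∑ j ∈ s, |b j| := Finset.sum_nonneg fun j _ => abs_nonneg _
    have h2 : (1 - |b i|) * ∏ j ∈ s, (1 + b j) ≤ (1 + b i) * ∏ j ∈ s, (1 + b j) :=
      mul_le_mul_of_nonneg_right (by linarith [neg_abs_le (b i)]) h0
    have h3 : (1 - |b i|) * (1 - ∑ j ∈ s, |b j|) ≤ (1 - |b i|) * ∏ j ∈ s, (1 + b j) :=
      mul_le_mul_of_nonneg_left ih (by linarith [hb i])
    nlinarith [mul_nonneg (abs_nonneg (b i)) h1]

/-! ### Conditional independence and its behaviour under disclosure of messages. -/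

section CondIndep

variable {Ω : Type*} {mΩ : MeasurableSpace Ω}

/-- Pull-out property: against a bounded `m`-measurable test function, `f` is indistinguishable from
its conditional expectation. -/
lemma integral_condExp_mul (μ : Measure Ω) [IsProbabilityMeasure μ] {m : MeasurableSpace Ω}
    (hm : m ≤ mΩ) {f g : Ω → ℝ} (hf : Integrable f μ) (hg : StronglyMeasurable[m] g) {C : ℝ}
    (hC : ∀ᵐ ω ∂μ, ‖g ω‖ ≤ C) : ∫ ω, f ω * g ω ∂μ = ∫ ω, (μ[f|m]) ω * g ω ∂μ := by
  have hfg : Integrable (f * g) μ :=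
    hf.mul_bdd (c := C) (hg.mono hm).aestronglyMeasurable hC
  have h := condExp_mul_of_stronglyMeasurable_right (μ := μ) hg hfg hf
  calc ∫ ω, f ω * g ω ∂μ = ∫ ω, (μ[f * g|m]) ω ∂μ := (integral_condExp hm).symm
    _ = _ := integral_congr_ae h

/-- Conditional independence of the σ-algebras `A` and `B` given `G`, for `G ≤ A`: conditioning an
event of `B` on `A` is the same as conditioning it on `G`. -/
def CondIndepGiven (μ : Measure Ω) (A B G : MeasurableSpace Ω) : Prop :=
  ∀ V, MeasurableSet[B] V → μ[V.indicator (1 : Ω → ℝ)|A] =ᵐ[μ] μ[V.indicator (1 : Ω → ℝ)|G]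

lemma CondIndepGiven.mono_right {μ : Measure Ω} {A B B' G : MeasurableSpace Ω}
    (h : CondIndepGiven μ A B G) (hB : B' ≤ B) : CondIndepGiven μ A B' G :=
  fun V hV => h V (hB V hV)

lemma norm_condExp_indicator_le (μ : Measure Ω) [IsProbabilityMeasure μ] (m : MeasurableSpace Ω)
    (V : Set Ω) : ∀ᵐ ω ∂μ, ‖(μ[V.indicator (1 : Ω → ℝ)|m]) ω‖ ≤ 1 := by
  refine ae_bdd_abs_condExp_of_ae_bdd_abs (R := (1 : ℝ)) (Filter.Eventually.of_forall fun ω => ?_)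
  by_cases h : ω ∈ V <;> simp [h]

/-- The intersections `V ∩ W` form a π-system generating `B ⊔ G`. -/
lemma setIntegral_congr_of_inter {μ : Measure Ω} {f g : Ω → ℝ}
    (hf : Integrable f μ) (hg : Integrable g μ) {B G : MeasurableSpace Ω} (hB : B ≤ mΩ)
    (hG : G ≤ mΩ) (h : ∀ V W, MeasurableSet[B] V → MeasurableSet[G] W →
      ∫ ω in V ∩ W, f ω ∂μ = ∫ ω in V ∩ W, g ω ∂μ) (s : Set Ω) (hs : MeasurableSet[B ⊔ G] s) :
    ∫ ω in s, f ω ∂μ = ∫ ω in s, g ω ∂μ := by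
  have hle : B ⊔ G ≤ mΩ := sup_le hB hG
  let C : Set (Set Ω) := {s | ∃ V W, MeasurableSet[B] V ∧ MeasurableSet[G] W ∧ V ∩ W = s}
  have hgen : B ⊔ G = MeasurableSpace.generateFrom C := by
    apply le_antisymm
    · refine sup_le (fun V hV => ?_) (fun W hW => ?_)
      · exact MeasurableSpace.measurableSet_generateFrom
          ⟨V, Set.univ, hV, MeasurableSet.univ, by simp⟩
      · exact MeasurableSpace.measurableSet_generateFrom
          ⟨Set.univ, W, MeasurableSet.univ, hW, by simp⟩
    · refine MeasurableSpace.generateFrom_le ?_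
      rintro _ ⟨V, W, hV, hW, rfl⟩
      exact MeasurableSet.inter ((le_sup_left : B ≤ B ⊔ G) V hV) ((le_sup_right : G ≤ B ⊔ G) W hW)
  have hpi : IsPiSystem C := by
    rintro _ ⟨V, W, hV, hW, rfl⟩ _ ⟨V', W', hV', hW', rfl⟩ _
    exact ⟨V ∩ V', W ∩ W', hV.inter hV', hW.inter hW', by
      ext; simp only [Set.mem_inter_iff]; tauto⟩
  have huniv : ∫ ω, f ω ∂μ = ∫ ω, g ω ∂μ := by
    simpa using h Set.univ Set.univ MeasurableSet.univ MeasurableSet.univ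
  refine MeasurableSpace.induction_on_inter (m := B ⊔ G)
    (C := fun s _ => ∫ ω in s, f ω ∂μ = ∫ ω in s, g ω ∂μ) hgen hpi ?_ ?_ ?_ ?_ s hs
  · simp
  · rintro _ ⟨V, W, hV, hW, rfl⟩
    exact h V W hV hW
  · intro t ht ih
    rw [setIntegral_compl (hle t ht) hf, setIntegral_compl (hle t ht) hg, ih, huniv]
  · intro t hd ht ih
    rw [integral_iUnion (fun i => hle _ (ht i)) hd hf.integrableOn,
      integral_iUnion (fun i => hle _ (ht i)) hd hg.integrableOn]
    simp_rw [ih]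

lemma setIntegral_inter_eq_integral_mul {μ : Measure Ω} {V W : Set Ω} (hV : MeasurableSet V)
    (hW : MeasurableSet W) (f : Ω → ℝ) :
    ∫ ω in V ∩ W, f ω ∂μ = ∫ ω, V.indicator 1 ω * W.indicator f ω ∂μ := by
  rw [← integral_indicator (hV.inter hW)]
  congr 1 with ω
  by_cases hωV : ω ∈ V <;> by_cases hωW : ω ∈ W <;> simp [hωV, hωW]

/-- Information `G'` read off from `A` and disclosed to both sides keeps them conditionally
independent. -/
lemma CondIndepGiven.disclose {μ : Measure Ω} [IsProbabilityMeasure μ]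
    {A B G G' : MeasurableSpace Ω} (h : CondIndepGiven μ A B G) (hA : A ≤ mΩ) (hB : B ≤ mΩ)
    (hGG' : G ≤ G') (hG'A : G' ≤ A) : CondIndepGiven μ (B ⊔ G') A G' := by
  intro U hU
  have hG' : G' ≤ mΩ := hG'A.trans hA
  have hUi : Integrable (U.indicator (1 : Ω → ℝ)) μ :=
    (integrable_const (1 : ℝ)).indicator (hA U hU)
  refine (ae_eq_condExp_of_forall_setIntegral_eq (sup_le hB hG') hUi
    (fun s _ _ => integrable_condExp.integrableOn) (fun s hs _ => ?_) ?_).symm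
  · refine setIntegral_congr_of_inter integrable_condExp hUi hB hG' (fun V W hV hW => ?_) s hs
    have hVi : Integrable (V.indicator (1 : Ω → ℝ)) μ :=
      (integrable_const (1 : ℝ)).indicator (hB V hV)
    have hbd : ∀ᵐ ω ∂μ, ‖W.indicator (μ[U.indicator (1 : Ω → ℝ)|G']) ω‖ ≤ 1 := by
      filter_upwards [norm_condExp_indicator_le μ G' U] with ω hω
      exact (norm_indicator_le_norm_self _ _).trans hω
    have hbd' : ∀ᵐ ω ∂μ, ‖W.indicator (μ[V.indicator (1 : Ω → ℝ)|G]) ω‖ ≤ 1 := by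
      filter_upwards [norm_condExp_indicator_le μ G V] with ω hω
      exact (norm_indicator_le_norm_self _ _).trans hω
    have hbdU : ∀ᵐ ω ∂μ, ‖W.indicator (U.indicator (1 : Ω → ℝ)) ω‖ ≤ 1 :=
      Filter.Eventually.of_forall fun ω => by
        by_cases h : ω ∈ U <;> by_cases h' : ω ∈ W <;> simp [h, h']
    have hmU : StronglyMeasurable[A] (W.indicator (U.indicator (1 : Ω → ℝ))) :=
      (stronglyMeasurable_one.indicator hU).indicator (hG'A W hW)
    have hmG : StronglyMeasurable[G'] (W.indicator (μ[V.indicator (1 : Ω → ℝ)|G])) :=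
      (stronglyMeasurable_condExp.mono hGG').indicator hW
    -- On both sides the factor of `V` is paired with an `A`-measurable function, so it becomes its
    -- conditional probability given `A`, which by hypothesis is the one given `G`. The latter is
    -- `G'`-measurable, so on the right `U` may in turn be replaced by its conditional probability
    -- given `G'`.
    rw [setIntegral_inter_eq_integral_mul (hB V hV) (hG' W hW),
      setIntegral_inter_eq_integral_mul (hB V hV) (hG' W hW),
      integral_condExp_mul μ hA hVi
        ((stronglyMeasurable_condExp.indicator hW).mono hG'A) hbd,
      integral_condExp_mul μ hA hVi hmU hbdU,
      integral_congr_ae (g := fun ω => (μ[U.indicator (1 : Ω → ℝ)|G']) ω *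
        W.indicator (μ[V.indicator (1 : Ω → ℝ)|G]) ω),
      ← integral_condExp_mul μ hG' hUi hmG hbd']
    · refine integral_congr_ae ?_
      filter_upwards [h V hV] with ω hω
      by_cases h' : ω ∈ W <;> simp [h', hω, mul_comm]
    · filter_upwards [h V hV] with ω hω
      by_cases h' : ω ∈ W <;> simp [h', hω, mul_comm]
  · exact ((stronglyMeasurable_condExp (m := G')).mono
      (le_sup_right : G' ≤ B ⊔ G')).aestronglyMeasurable

lemma condIndepGiven_bot {μ : Measure Ω} [IsProbabilityMeasure μ] {A B : MeasurableSpace Ω}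
    (hA : A ≤ mΩ) (hB : B ≤ mΩ) (h : ProbabilityTheory.Indep A B μ) :
    CondIndepGiven μ A B ⊥ := by
  intro V hV
  rw [condExp_bot]
  exact condExp_indep_eq hB hA (stronglyMeasurable_one.indicator hV) h.symm

/-- One more message `f`, sent by the side `A` on the event `E` and by the side `B` otherwise. -/
lemma CondIndepGiven.message {R : Type*} [mR : MeasurableSpace R] {μ : Measure Ω}
    [IsProbabilityMeasure μ] {A B G : MeasurableSpace Ω} (h : CondIndepGiven μ (A ⊔ G) (B ⊔ G) G)
    (hA : A ≤ mΩ) (hB : B ≤ mΩ) (hG : G ≤ mΩ) {E : Set Ω} (hE : MeasurableSet[G] E)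
    {f g : Ω → R} {fA fB : Ω → R} (hg : Measurable[G] g)
    (hfA : Measurable[A ⊔ G] fA) (hffA : ∀ ω ∈ E, f ω = fA ω)
    (hfB : Measurable[B ⊔ G] fB) (hffB : ∀ ω ∉ E, f ω = fB ω) :
    CondIndepGiven μ (A ⊔ (G ⊔ mR.comap f)) (B ⊔ (G ⊔ mR.comap f)) (G ⊔ mR.comap f) := by
  classical
  have hE₁ : ∀ m : MeasurableSpace Ω, G ≤ m → MeasurableSet[m] E := fun m hm => hm E hE
  -- The message is cut into two: the part sent by `A`, and the part sent by `B`. Where a part is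
  -- silent it shows the already public `g`, so both together carry the same information as `f`.
  set G₁ := G ⊔ mR.comap (E.piecewise f g) with hG₁
  set G₂ := G₁ ⊔ mR.comap (E.piecewise g f) with hG₂
  have hG₂eq : G₂ = G ⊔ mR.comap f := by
    apply le_antisymm
    · have hf : Measurable[G ⊔ mR.comap f] f :=
        (comap_measurable f).mono le_sup_right le_rfl
      have hg' : Measurable[G ⊔ mR.comap f] g := hg.mono le_sup_left le_rfl
      refine sup_le (sup_le le_sup_left ?_) ?_
      · exact (Measurable.piecewise (hE₁ (G ⊔ mR.comap f) le_sup_left) hf hg').comap_le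
      · exact (Measurable.piecewise (hE₁ (G ⊔ mR.comap f) le_sup_left) hg' hf).comap_le
    · refine sup_le (le_sup_left.trans le_sup_left) ?_
      have h1 : Measurable[G₂] (E.piecewise f g) :=
        (comap_measurable _).mono (le_sup_right.trans le_sup_left) le_rfl
      have h2 : Measurable[G₂] (E.piecewise g f) :=
        (comap_measurable _).mono le_sup_right le_rfl
      have h3 : f = E.piecewise (E.piecewise f g) (E.piecewise g f) := by
        ext ω; by_cases hω : ω ∈ E <;> simp [hω]
      rw [h3]
      exact (Measurable.piecewise (hE₁ G₂ (le_sup_left.trans le_sup_left)) h1 h2).comap_le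
  have hA₁ : Measurable[A ⊔ G] (E.piecewise f g) := by
    have h3 : E.piecewise f g = E.piecewise fA g := by
      ext ω; by_cases hω : ω ∈ E <;> simp [hω, hffA]
    rw [h3]
    exact Measurable.piecewise (hE₁ (A ⊔ G) le_sup_right) hfA (hg.mono le_sup_right le_rfl)
  have hB₁ : Measurable[B ⊔ G] (E.piecewise g f) := by
    have h3 : E.piecewise g f = E.piecewise g fB := by
      ext ω; by_cases hω : ω ∈ E <;> simp [hω, hffB]
    rw [h3]
    exact Measurable.piecewise (hE₁ (B ⊔ G) le_sup_right) (hg.mono le_sup_right le_rfl) hfB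
  have hG₁A : G₁ ≤ A ⊔ G := sup_le le_sup_right hA₁.comap_le
  have hG₁' : G₁ ≤ mΩ := hG₁A.trans (sup_le hA hG)
  have hG₂B : G₂ ≤ (B ⊔ G) ⊔ G₁ := sup_le le_sup_right (hB₁.comap_le.trans le_sup_left)
  -- Each disclosure exchanges the roles of the two sides, so two of them restore the order.
  have h1 := h.disclose (sup_le hA hG) (sup_le hB hG) le_sup_left hG₁A
  have h2 := h1.disclose (sup_le (sup_le hB hG) hG₁') (sup_le hA hG) le_sup_left hG₂B
  have hGG₂ : G ≤ G₂ := le_sup_left.trans le_sup_left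
  rw [← hG₂eq]
  rw [sup_assoc, sup_eq_right.2 hGG₂] at h2
  exact h2.mono_right (sup_le (le_sup_left.trans le_sup_left) hG₂B)

/-- A version of the conditional probability given `G` of an event of `A`, which serves for all test
functions measurable with respect to the conditionally independent side `B`. -/
lemma CondIndepGiven.exists_condProb {μ : Measure Ω} [IsProbabilityMeasure μ]
    {A B G : MeasurableSpace Ω} (h : CondIndepGiven μ B A G) (hA : A ≤ mΩ) (hB : B ≤ mΩ)
    {V : Set Ω} (hV : MeasurableSet[A] V) :
    ∃ p : Ω → ℝ, StronglyMeasurable[G] p ∧ (∀ ω, 0 ≤ p ω ∧ p ω ≤ 1) ∧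
      ∀ F : Ω → ℝ, StronglyMeasurable[B] F → ∀ C : ℝ, (∀ ω, ‖F ω‖ ≤ C) →
        ∫ ω, V.indicator 1 ω * F ω ∂μ = ∫ ω, p ω * F ω ∂μ := by
  have hVi : Integrable (V.indicator (1 : Ω → ℝ)) μ :=
    (integrable_const (1 : ℝ)).indicator (hA V hV)
  -- Truncation to `[0, 1]` makes the bounds hold everywhere and alters the conditional probability
  -- only on a null set.
  refine ⟨fun ω => max 0 (min 1 ((μ[V.indicator (1 : Ω → ℝ)|G]) ω)),
    (stronglyMeasurable_const (b := (0 : ℝ))).sup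
      ((stronglyMeasurable_const (b := (1 : ℝ))).inf stronglyMeasurable_condExp),
    fun ω => ⟨le_max_left _ _, max_le zero_le_one (min_le_left _ _)⟩, fun F hF C hC => ?_⟩
  rw [integral_condExp_mul μ hB hVi hF (Filter.Eventually.of_forall hC)]
  have h0 : 0 ≤ᵐ[μ] μ[V.indicator (1 : Ω → ℝ)|G] :=
    condExp_nonneg (Filter.Eventually.of_forall fun ω =>
      Set.indicator_nonneg (fun _ _ => zero_le_one) ω)
  refine integral_congr_ae ?_
  filter_upwards [h V hV, h0, norm_condExp_indicator_le μ G V] with ω h1 h2 h3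
  have hnonneg : 0 ≤ (μ[V.indicator (1 : Ω → ℝ)|G]) ω := h2
  rw [h1, min_eq_right ((le_abs_self _).trans h3), max_eq_right hnonneg]

/-- In the integral of a product, factors may be replaced one by one by their conditional versions
given `G`. -/
lemma integral_prod_one_add_replace {ι : Type*} [Fintype ι] {μ : Measure Ω}
    [IsProbabilityMeasure μ] {G : MeasurableSpace Ω} {B : ι → MeasurableSpace Ω}
    (hGB : ∀ i, G ≤ B i) (hB : ∀ i, B i ≤ mΩ) {f b : ι → Ω → ℝ}
    (hfm : ∀ i, StronglyMeasurable[mΩ] (f i)) (hf : ∀ i j, j ≠ i → StronglyMeasurable[B i] (f j))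
    (hb : ∀ i, StronglyMeasurable[G] (b i)) (hf1 : ∀ i ω, |f i ω| ≤ 1) (hb1 : ∀ i ω, |b i ω| ≤ 1)
    (hrep : ∀ i F, StronglyMeasurable[B i] F → ∀ C : ℝ, (∀ ω, ‖F ω‖ ≤ C) →
      ∫ ω, f i ω * F ω ∂μ = ∫ ω, b i ω * F ω ∂μ)
    {g : Ω → ℝ} (hg : StronglyMeasurable[G] g) (hg1 : ∀ ω, |g ω| ≤ 1) :
    ∫ ω, g ω * ∏ i, (1 + f i ω) ∂μ = ∫ ω, g ω * ∏ i, (1 + b i ω) ∂μ := by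
  classical
  suffices H : ∀ s : Finset ι, ∫ ω, g ω * ∏ i, (1 + f i ω) ∂μ =
      ∫ ω, g ω * ((∏ i ∈ s, (1 + b i ω)) * ∏ i ∈ sᶜ, (1 + f i ω)) ∂μ by
    simpa using H Finset.univ
  intro s
  induction s using Finset.induction_on with
  | empty => simp
  | insert i s hi ih =>
    rw [ih]
    -- All that multiplies the factor of `i`. The unreplaced factors in it belong to other indices,
    -- so it is measurable for `B i` and `hrep` applies to it.
    set F : Ω → ℝ := fun ω =>
      g ω * ((∏ j ∈ s, (1 + b j ω)) * ∏ j ∈ (insert i s)ᶜ, (1 + f j ω)) with hF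
    have hFm : StronglyMeasurable[B i] F := by
      refine (hg.mono (hGB i)).mul (StronglyMeasurable.mul ?_ ?_)
      · exact Finset.stronglyMeasurable_fun_prod s fun j _ =>
          stronglyMeasurable_const.add ((hb j).mono (hGB i))
      · refine Finset.stronglyMeasurable_fun_prod _ fun j hj =>
          stronglyMeasurable_const.add (hf i j ?_)
        rintro rfl
        simp at hj
    have two : ∀ a : ℝ, |a| ≤ 1 → |1 + a| ≤ 2 := fun a ha =>
      (abs_add_le 1 a).trans (by rw [abs_one]; linarith)
    have hFC : ∀ ω, ‖F ω‖ ≤ 1 * (2 ^ s.card * 2 ^ (insert i s)ᶜ.card) := by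
      intro ω
      rw [hF, Real.norm_eq_abs, abs_mul, abs_mul, Finset.abs_prod, Finset.abs_prod]
      gcongr
      · exact hg1 ω
      · exact (Finset.prod_le_prod (fun _ _ => abs_nonneg _)
          fun j _ => two _ (hb1 j ω)).trans_eq (by simp)
      · exact (Finset.prod_le_prod (fun _ _ => abs_nonneg _)
          fun j _ => two _ (hf1 j ω)).trans_eq (by simp)
    have hFi : Integrable F μ := by
      refine Integrable.of_bound (hFm.mono (hB i)).aestronglyMeasurable _
        (Filter.Eventually.of_forall hFC)
    have hsplit : sᶜ = insert i (insert i s)ᶜ := by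
      ext j
      by_cases hj : j = i
      · subst hj; simp [hi]
      · simp [hj]
    have hfF : Integrable (fun ω => f i ω * F ω) μ :=
      hFi.bdd_mul (c := 1) (hfm i).aestronglyMeasurable (Filter.Eventually.of_forall (hf1 i))
    have hbF : Integrable (fun ω => b i ω * F ω) μ :=
      hFi.bdd_mul (c := 1) ((hb i).mono ((hGB i).trans (hB i))).aestronglyMeasurable
        (Filter.Eventually.of_forall (hb1 i))
    calc _ = ∫ ω, F ω + f i ω * F ω ∂μ := by
          congr 1 with ω
          rw [hsplit, Finset.prod_insert (by simp)]
          simp only [hF]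
          ring
      _ = ∫ ω, F ω + b i ω * F ω ∂μ := by
          rw [integral_add hFi hfF, integral_add hFi hbF, hrep i F hFm _ hFC]
      _ = _ := by
          congr 1 with ω
          rw [Finset.prod_insert hi]
          simp only [hF]
          ring

end CondIndep

/-! ### The rest of the protocol as an adversary against one agent. -/

noncomputable section

namespace LocalProtocol

variable {X : Type v} {Q M : Type u} {O : Type w}
  [MeasurableSpace Q] [MeasurableSpace M] [MeasurableSpace O] {n : ℕ}

/-- The referee and the asked agent never look at the state of an agent that is not asked. -/
lemma step_update_of_ne (P : LocalProtocol X Q M O n) (i : Fin n) (c : P.Config)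
    (hc : (P.referee.query c.1).1 ≠ i) (a : (P.agent i).State) :
    P.step (c.1, Function.update c.2 i a) =
      ((P.step c).1, Function.update (P.step c).2 i a) := by
  simp only [step, Function.update_of_ne hc]
  rw [Function.update_comm hc]

lemma step_update_of_eq (P : LocalProtocol X Q M O n) (i : Fin n) (c : P.Config)
    (hc : (P.referee.query c.1).1 = i) (a : (P.agent i).State) :
    P.step (c.1, Function.update c.2 i a) =
      (P.referee.receive (c.1, ((P.agent i).respond (a, (P.referee.query c.1).2)).1),
        Function.update c.2 i ((P.agent i).respond (a, (P.referee.query c.1).2)).2) := by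
  subst hc
  simp [step]

/-- One step of a run with a countdown of the remaining steps; it halts when the countdown is over
and whenever agent `i` is to be asked. -/
def skipStep (P : LocalProtocol X Q M O n) (i : Fin n) (z : ℕ × P.Config) : ℕ × P.Config :=
  if z.1 = 0 ∨ (P.referee.query z.2.1).1 = i then z else (z.1 - 1, P.step z.2)

lemma measurable_referee_query_config (P : LocalProtocol X Q M O n) :
    Measurable fun z : ℕ × P.Config => P.referee.query z.2.1 :=
  P.referee.measurable_query.comp (measurable_fst.comp measurable_snd)

lemma measurable_skipStep (P : LocalProtocol X Q M O n) (i : Fin n) :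
    Measurable (P.skipStep i) := by
  refine Measurable.ite ?_ measurable_id
    (((measurable_from_top (f := fun m : ℕ => m - 1)).comp measurable_fst).prodMk
      (P.measurable_step.comp measurable_snd))
  refine MeasurableSet.union (measurable_fst (measurableSet_singleton 0)) ?_
  exact (measurable_fst.comp P.measurable_referee_query_config) (measurableSet_singleton i)

/-- The run without agent `i` until that agent is asked. -/
def skip (P : LocalProtocol X Q M O n) (i : Fin n) (N : ℕ) (z : ℕ × P.Config) : ℕ × P.Config :=
  (P.skipStep i)^[N] z

lemma measurable_skip (P : LocalProtocol X Q M O n) (i : Fin n) (N : ℕ) :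
    Measurable (P.skip i N) :=
  (P.measurable_skipStep i).iterate N

/-- The adversary that plays the referee and all agents but agent `i` for `N` steps. -/
def worldAdversary (P : LocalProtocol X Q M O n) (i : Fin n) (N : ℕ) (c : P.Config) :
    Interrogator Q M P.referee.State where
  State := ℕ × P.Config
  start := Measure.dirac (N, c)
  query z := (P.referee.query (P.skip i N z).2.1).2
  measurable_query := measurable_snd.comp
    (P.measurable_referee_query_config.comp (P.measurable_skip i N))
  -- `query` cannot change the state, so the skipping is repeated here. Once the countdown is over
  -- the answer is discarded, so surplus exchanges are harmless.
  receive p := if (P.skip i N p.1).1 = 0 then P.skip i N p.1 else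
    ((P.skip i N p.1).1 - 1,
      (P.referee.receive ((P.skip i N p.1).2.1, p.2), (P.skip i N p.1).2.2))
  measurable_receive := by
    have h : Measurable fun p : (ℕ × P.Config) × M => P.skip i N p.1 :=
      (P.measurable_skip i N).comp measurable_fst
    refine Measurable.ite ((measurable_fst.comp h) (measurableSet_singleton 0)) h ?_
    refine ((measurable_from_top (f := fun m : ℕ => m - 1)).comp (measurable_fst.comp h)).prodMk ?_
    exact (P.referee.measurable_receive.comp
      ((measurable_fst.comp (measurable_snd.comp h)).prodMk measurable_snd)).prodMk
      (measurable_snd.comp (measurable_snd.comp h))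
  output z := z.2.1
  measurable_output := measurable_fst.comp measurable_snd

/-- The state of the referee after the countdown is over, when agent `i` is in state `a`. -/
def finalReferee (P : LocalProtocol X Q M O n) (i : Fin n) (z : ℕ × P.Config)
    (a : (P.agent i).State) : P.referee.State :=
  (P.step^[z.1] (z.2.1, Function.update z.2.2 i a)).1

/-- `finalReferee` is the invariant of the simulation: skipped steps do not ask agent `i`, hence
commute with inserting its state. -/
lemma finalReferee_skip (P : LocalProtocol X Q M O n) (i : Fin n) (N : ℕ) (z : ℕ × P.Config)
    (a : (P.agent i).State) : P.finalReferee i (P.skip i N z) a = P.finalReferee i z a := by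
  induction N generalizing z with
  | zero => rfl
  | succ N ih =>
    rw [skip, Function.iterate_succ_apply]
    refine (ih _).trans ?_
    unfold skipStep
    split_ifs with h
    · rfl
    · push Not at h
      obtain ⟨m, c⟩ := z
      obtain ⟨m, rfl⟩ := Nat.exists_eq_succ_of_ne_zero h.1
      simp only [finalReferee, Nat.succ_eq_add_one, Nat.add_sub_cancel,
        Function.iterate_succ_apply]
      rw [step_update_of_ne P i c h.2]

/-- If the countdown starts at no more than `N`, the last alternative leaves it at zero; so `N`
skipping steps always reach the end or a query to agent `i`. -/
lemma skip_spec (P : LocalProtocol X Q M O n) (i : Fin n) (N : ℕ) (z : ℕ × P.Config) :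
    (P.skip i N z).1 ≤ z.1 ∧ ((P.skip i N z).1 = 0 ∨
      (P.referee.query (P.skip i N z).2.1).1 = i ∨ (P.skip i N z).1 + N ≤ z.1) := by
  induction N with
  | zero => exact ⟨le_rfl, Or.inr (Or.inr le_rfl)⟩
  | succ N ih =>
    have hs : P.skip i (N + 1) z = P.skipStep i (P.skip i N z) :=
      Function.iterate_succ_apply' _ _ _
    rw [hs, skipStep]
    split_ifs with h
    · exact ⟨ih.1, h.elim Or.inl fun h => Or.inr (Or.inl h)⟩
    · push Not at h
      refine ⟨(Nat.sub_le _ _).trans ih.1, Or.inr (Or.inr ?_)⟩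
      have := (ih.2.resolve_left h.1).resolve_left h.2
      have := h.1
      simp only
      omega

/-- An exchange keeps the invariant and uses up at least one unit of a nonzero countdown, so `N`
exchanges complete the run. -/
lemma exchange_worldAdversary (P : LocalProtocol X Q M O n) (i : Fin n) (N : ℕ) (c : P.Config)
    (z : ℕ × P.Config) (hz : z.1 ≤ N) (a : (P.agent i).State) :
    ((P.agent i).exchange (P.worldAdversary i N c) (z, a)).1.1 ≤ z.1 - 1 ∧
    P.finalReferee i ((P.agent i).exchange (P.worldAdversary i N c) (z, a)).1
      ((P.agent i).exchange (P.worldAdversary i N c) (z, a)).2 = P.finalReferee i z a := by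
  rw [← P.finalReferee_skip i N z a]
  obtain ⟨hle, hcase⟩ := P.skip_spec i N z
  simp only [Agent.exchange, worldAdversary]
  generalize hz' : P.skip i N z = z' at *
  obtain ⟨m, σ, s⟩ := z'
  split_ifs with h
  · simp only at h hle ⊢
    subst h
    exact ⟨Nat.zero_le _, rfl⟩
  · simp only at h hle hcase ⊢
    obtain ⟨m, rfl⟩ := Nat.exists_eq_succ_of_ne_zero h
    have hq : (P.referee.query σ).1 = i := by
      rcases hcase with h' | h' | h'
      · exact absurd h' h
      · exact h'
      · omega
    refine ⟨by omega, ?_⟩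
    simp only [finalReferee, Nat.succ_eq_add_one, Nat.add_sub_cancel,
      Function.iterate_succ_apply]
    rw [step_update_of_eq P i (σ, s) hq]

lemma iterate_exchange_worldAdversary (P : LocalProtocol X Q M O n) (i : Fin n) (N : ℕ)
    (c : P.Config) (k : ℕ) (z : ℕ × P.Config) (hz : z.1 ≤ N) (hk : z.1 ≤ k)
    (a : (P.agent i).State) :
    (((P.agent i).exchange (P.worldAdversary i N c))^[k] (z, a)).1.2.1 =
      P.finalReferee i z a := by
  induction k generalizing z a with
  | zero =>
    obtain ⟨m, σ, s⟩ := z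
    obtain rfl : m = 0 := by simpa using hk
    rfl
  | succ k ih =>
    obtain ⟨h1, h2⟩ := P.exchange_worldAdversary i N c z hz a
    rw [Function.iterate_succ_apply, ← h2]
    exact ih _ (h1.trans (by omega)) (h1.trans (by omega)) _

/-- Privacy of agent `i` in a run where the coins of all other parties are fixed. -/
lemma IsDP.referee_state {P : LocalProtocol X Q M O n} {ε : ℝ} (h : P.IsDP ε 0) (i : Fin n)
    (N : ℕ) (σ : P.referee.State) (s : ∀ j, (P.agent j).State) (x x' : X)
    {T : Set P.referee.State} (hT : MeasurableSet T) :
    (P.agent i).start x {a | (P.step^[N] (σ, Function.update s i a)).1 ∈ T} ≤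
      ENNReal.ofReal (Real.exp ε) *
        (P.agent i).start x' {a | (P.step^[N] (σ, Function.update s i a)).1 ∈ T} := by
  have hout : ∀ x, (P.agent i).adversaryOutput (P.worldAdversary i N (σ, s)) N x T =
      (P.agent i).start x {a | (P.step^[N] (σ, Function.update s i a)).1 ∈ T} := by
    intro x
    have hm : Measurable fun z : (P.worldAdversary i N (σ, s)).State × (P.agent i).State =>
        (P.worldAdversary i N (σ, s)).output
          (((P.agent i).exchange (P.worldAdversary i N (σ, s)))^[N] z).1 :=
      (P.worldAdversary i N (σ, s)).measurable_output.comp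
        (measurable_fst.comp (((P.agent i).measurable_exchange _).iterate N))
    let z₀ : (P.worldAdversary i N (σ, s)).State := (N, (σ, s))
    have hstart : (P.worldAdversary i N (σ, s)).start = Measure.dirac z₀ := rfl
    rw [Agent.adversaryOutput, Measure.map_apply hm hT, hstart, Measure.dirac_prod,
      Measure.map_apply measurable_prodMk_left (hm hT)]
    congr 1 with a
    have := P.iterate_exchange_worldAdversary i N (σ, s) N (N, (σ, s)) le_rfl le_rfl a
    simp only [Set.mem_preimage, Set.mem_ofPred_eq]
    change (((P.agent i).exchange (P.worldAdversary i N (σ, s)))^[N] ((N, (σ, s)), a)).1.2.1 ∈ T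
      ↔ _
    rw [this]
    rfl
  have := (h i P.referee.State (P.worldAdversary i N (σ, s)) N x x' T hT).1
  simpa [hout] using this

/-- The state of the referee after `t` steps, and before that, in reverse order of time. -/
def history (P : LocalProtocol X Q M O n) (t : ℕ) (c : P.Config) : ℕ → P.referee.State :=
  -- By truncated subtraction the entries with `l > t` repeat the initial state.
  fun l => (P.step^[t - l] c).1

lemma measurable_history (P : LocalProtocol X Q M O n) (t : ℕ) : Measurable (P.history t) :=
  measurable_pi_lambda _ fun l => measurable_fst.comp (P.measurable_step.iterate (t - l))

/-- Add a term at the beginning of a sequence. -/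
def consSeq {R : Type u} (a : R) (h : ℕ → R) : ℕ → R
  | 0 => a
  | l + 1 => h l

lemma history_succ (P : LocalProtocol X Q M O n) (t : ℕ) (c : P.Config) :
    P.history (t + 1) c = consSeq (P.step^[t + 1] c).1 (P.history t c) := by
  funext l
  cases l with
  | zero => rfl
  | succ l => simp [history, consSeq]

/-- The protocol with a referee that remembers its past states. -/
def record (P : LocalProtocol X Q M O n) (σ : P.referee.State) :
    LocalProtocol X Q M (ℕ → P.referee.State) n where
  agent := P.agent
  referee :=
    { State := ℕ → P.referee.State
      -- The constant sequence agrees with the truncated entries of `history`.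
      start := Measure.dirac fun _ => σ
      query := fun h => P.referee.query (h 0)
      measurable_query := P.referee.measurable_query.comp (measurable_pi_apply 0)
      receive := fun p => consSeq (P.referee.receive (p.1 0, p.2)) p.1
      measurable_receive := by
        refine measurable_pi_lambda _ fun l => ?_
        cases l with
        | zero =>
          exact P.referee.measurable_receive.comp
            (((measurable_pi_apply 0).comp measurable_fst).prodMk measurable_snd)
        | succ l => exact (measurable_pi_apply l).comp measurable_fst
      output := id
      measurable_output := measurable_id }
  messages := P.messages

lemma iterate_step_record (P : LocalProtocol X Q M O n) (σ : P.referee.State) (t : ℕ)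
    (s : ∀ j, (P.agent j).State) :
    (P.record σ).step^[t] (fun _ => σ, s) =
      (P.history t (σ, s), (P.step^[t] (σ, s)).2) := by
  induction t with
  | zero =>
    simp only [Function.iterate_zero, id_eq]
    congr 1
    funext l
    simp [history]
  | succ t ih =>
    rw [Function.iterate_succ_apply', ih, history_succ, Function.iterate_succ_apply']
    rfl

/-- Privacy of agent `i` with respect to the history of the referee, in a run where the coins of
all other parties are fixed. -/
lemma IsDP.history {P : LocalProtocol X Q M O n} {ε : ℝ} (h : P.IsDP ε 0) (i : Fin n)
    (N : ℕ) (σ : P.referee.State) (s : ∀ j, (P.agent j).State) (x x' : X)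
    {T : Set (ℕ → P.referee.State)} (hT : MeasurableSet T) :
    (P.agent i).start x {a | P.history N (σ, Function.update s i a) ∈ T} ≤
      ENNReal.ofReal (Real.exp ε) *
        (P.agent i).start x' {a | P.history N (σ, Function.update s i a) ∈ T} := by
  -- Privacy is a property of the agents alone, and recording changes only the referee.
  have hrec : (P.record σ).IsDP ε 0 := h
  have := hrec.referee_state i N (fun _ => σ) s x x' hT
  have hst : ∀ a, ((P.record σ).step^[N] (fun _ => σ, Function.update s i a)).1 =
      P.history N (σ, Function.update s i a) := fun a => by
    erw [P.iterate_step_record σ N (Function.update s i a)]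
  simp_rw [hst] at this
  exact this

end LocalProtocol

end

/-! ### Uniform inputs, transcripts, and independence of the agents given the transcript. -/

noncomputable section

namespace LocalProtocol

open scoped ENNReal

variable {d n : ℕ} {Q M : Type u} {O : Type w}
  [MeasurableSpace Q] [MeasurableSpace M] [MeasurableSpace O]

/-- The joint law of the input and the initial state of agent `i`, for a uniform input. -/
def coinLaw (P : LocalProtocol (Fin d → Bool) Q M O n) (i : Fin n) :
    Measure ((Fin d → Bool) × (P.agent i).State) :=
  ∑ x, ((2 : ℝ≥0∞) ^ d)⁻¹ • ((P.agent i).start x).map (Prod.mk x)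

lemma sum_inv_two_pow : ∑ _x : Fin d → Bool, ((2 : ℝ≥0∞) ^ d)⁻¹ = 1 := by
  simp [ENNReal.mul_inv_cancel]

lemma lintegral_coinLaw (P : LocalProtocol (Fin d → Bool) Q M O n) (i : Fin n)
    {f : (Fin d → Bool) × (P.agent i).State → ℝ≥0∞} (hf : Measurable f) :
    ∫⁻ p, f p ∂P.coinLaw i =
      ∑ x, ((2 : ℝ≥0∞) ^ d)⁻¹ * ∫⁻ a, f (x, a) ∂(P.agent i).start x := by
  rw [coinLaw, lintegral_finsetSum_measure]
  refine Finset.sum_congr rfl fun x _ => ?_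
  rw [lintegral_smul_measure, lintegral_map hf measurable_prodMk_left, smul_eq_mul]

instance (P : LocalProtocol (Fin d → Bool) Q M O n) (i : Fin n) :
    IsProbabilityMeasure (P.coinLaw i) := by
  constructor
  rw [← lintegral_one, lintegral_coinLaw P i measurable_const]
  simpa using sum_inv_two_pow

/-- The inputs and initial states of all agents. -/
abbrev Coins (P : LocalProtocol (Fin d → Bool) Q M O n) : Type u :=
  ∀ i, (Fin d → Bool) × (P.agent i).State

/-- The joint law of inputs and initial states of all agents, for independent uniform inputs. -/
def coinsLaw (P : LocalProtocol (Fin d → Bool) Q M O n) : Measure P.Coins :=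
  Measure.pi P.coinLaw

instance (P : LocalProtocol (Fin d → Bool) Q M O n) : IsProbabilityMeasure P.coinsLaw := by
  unfold coinsLaw; infer_instance

/-- The configuration after `t` steps, if the referee starts in the state `σ`. -/
def run (P : LocalProtocol (Fin d → Bool) Q M O n) (σ : P.referee.State) (t : ℕ) (ω : P.Coins) :
    P.Config :=
  P.step^[t] (σ, fun i => (ω i).2)

/-- The past states of the referee after `t` steps. -/
def transcript (P : LocalProtocol (Fin d → Bool) Q M O n) (σ : P.referee.State) (t : ℕ)
    (ω : P.Coins) : ℕ → P.referee.State :=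
  P.history t (σ, fun i => (ω i).2)

lemma measurable_initial (P : LocalProtocol (Fin d → Bool) Q M O n) (σ : P.referee.State) :
    Measurable fun ω : P.Coins => ((σ, fun i => (ω i).2) : P.Config) :=
  measurable_const.prodMk
    (measurable_pi_lambda _ fun i => measurable_snd.comp (measurable_pi_apply i))

lemma measurable_run (P : LocalProtocol (Fin d → Bool) Q M O n) (σ : P.referee.State) (t : ℕ) :
    Measurable (P.run σ t) :=
  (P.measurable_step.iterate t).comp (P.measurable_initial σ)

lemma measurable_transcript (P : LocalProtocol (Fin d → Bool) Q M O n) (σ : P.referee.State)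
    (t : ℕ) : Measurable (P.transcript σ t) :=
  (P.measurable_history t).comp (P.measurable_initial σ)

/-- What the referee has seen after `t` steps. -/
@[reducible]
def publicInfo (P : LocalProtocol (Fin d → Bool) Q M O n) (σ : P.referee.State) (t : ℕ) :
    MeasurableSpace P.Coins :=
  MeasurableSpace.pi.comap (P.transcript σ t)

/-- What agent `i` knows in the beginning. -/
@[reducible]
def ownInfo (P : LocalProtocol (Fin d → Bool) Q M O n) (i : Fin n) : MeasurableSpace P.Coins :=
  MeasurableSpace.comap (fun ω => ω i) inferInstance

/-- What all agents but agent `i` know in the beginning. -/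
@[reducible]
def othersInfo (P : LocalProtocol (Fin d → Bool) Q M O n) (i : Fin n) :
    MeasurableSpace P.Coins :=
  ⨆ j ∈ ({i}ᶜ : Set (Fin n)), P.ownInfo j

lemma publicInfo_le (P : LocalProtocol (Fin d → Bool) Q M O n) (σ : P.referee.State) (t : ℕ) :
    P.publicInfo σ t ≤ MeasurableSpace.pi :=
  (P.measurable_transcript σ t).comap_le

lemma ownInfo_le (P : LocalProtocol (Fin d → Bool) Q M O n) (i : Fin n) :
    P.ownInfo i ≤ MeasurableSpace.pi :=
  (measurable_pi_apply i).comap_le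

lemma othersInfo_le (P : LocalProtocol (Fin d → Bool) Q M O n) (i : Fin n) :
    P.othersInfo i ≤ MeasurableSpace.pi :=
  iSup₂_le fun j _ => P.ownInfo_le j

lemma ownInfo_le_othersInfo (P : LocalProtocol (Fin d → Bool) Q M O n) {i j : Fin n}
    (h : j ≠ i) : P.ownInfo j ≤ P.othersInfo i :=
  le_iSup₂_of_le (f := fun j (_ : j ∈ ({i}ᶜ : Set (Fin n))) => P.ownInfo j) j h le_rfl

lemma indep_ownInfo_othersInfo (P : LocalProtocol (Fin d → Bool) Q M O n) (i : Fin n) :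
    ProbabilityTheory.Indep (P.ownInfo i) (P.othersInfo i) P.coinsLaw := by
  have h : ProbabilityTheory.iIndepFun (fun i (ω : P.Coins) => ω i) P.coinsLaw :=
    ProbabilityTheory.iIndepFun_pi (X := fun i a => a) fun i => aemeasurable_id
  have := ProbabilityTheory.indep_iSup_of_disjoint (fun i => P.ownInfo_le i) h
    (S := {i}) (T := {i}ᶜ) disjoint_compl_right
  simpa only [Set.mem_singleton_iff, iSup_iSup_eq_left] using this

lemma publicInfo_zero (P : LocalProtocol (Fin d → Bool) Q M O n) (σ : P.referee.State) :
    P.publicInfo σ 0 = ⊥ := by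
  have : P.transcript σ 0 = fun _ _ => σ := by
    funext ω l
    simp [transcript, history]
  rw [publicInfo, this, MeasurableSpace.comap_const]

lemma measurable_run_fst (P : LocalProtocol (Fin d → Bool) Q M O n) (σ : P.referee.State)
    (t : ℕ) : Measurable[P.publicInfo σ t] fun ω => (P.run σ t ω).1 :=
  (measurable_pi_apply 0).comp (comap_measurable (P.transcript σ t))

/-- One step discloses just the new state of the referee; this is the form needed for
`CondIndepGiven.message`. -/
lemma publicInfo_succ (P : LocalProtocol (Fin d → Bool) Q M O n) (σ : P.referee.State) (t : ℕ) :
    P.publicInfo σ (t + 1) = P.publicInfo σ t ⊔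
      MeasurableSpace.comap (fun ω => (P.run σ (t + 1) ω).1) inferInstance := by
  apply le_antisymm
  · refine Measurable.comap_le (m₁ := P.publicInfo σ t ⊔
      MeasurableSpace.comap (fun ω => (P.run σ (t + 1) ω).1) inferInstance) ?_
    refine @measurable_pi_lambda _ _ _ (P.publicInfo σ t ⊔
      MeasurableSpace.comap (fun ω => (P.run σ (t + 1) ω).1) inferInstance) _ _ fun l => ?_
    cases l with
    | zero => exact (comap_measurable _).mono le_sup_right le_rfl
    | succ l =>
      have h : (fun ω => P.transcript σ (t + 1) ω (l + 1)) = fun ω => P.transcript σ t ω l := by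
        funext ω
        simp [transcript, history]
      rw [h]
      exact ((measurable_pi_apply l).comp (comap_measurable (P.transcript σ t))).mono
        le_sup_left le_rfl
  · refine sup_le ?_ (P.measurable_run_fst σ (t + 1)).comap_le
    refine Measurable.comap_le (m₁ := P.publicInfo σ (t + 1)) ?_
    refine @measurable_pi_lambda _ _ _ (P.publicInfo σ (t + 1)) _ _ fun l => ?_
    have h : (fun ω => P.transcript σ t ω l) = fun ω => P.transcript σ (t + 1) ω (l + 1) := by
      funext ω
      simp [transcript, history]
    rw [h]
    exact (measurable_pi_apply (l + 1)).comp (comap_measurable (P.transcript σ (t + 1)))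

lemma run_succ (P : LocalProtocol (Fin d → Bool) Q M O n) (σ : P.referee.State) (t : ℕ)
    (ω : P.Coins) : P.run σ (t + 1) ω = P.step (P.run σ t ω) :=
  Function.iterate_succ_apply' _ _ _

lemma measurable_asked (P : LocalProtocol (Fin d → Bool) Q M O n) (σ : P.referee.State) (t : ℕ)
    (i : Fin n) :
    MeasurableSet[P.publicInfo σ t] {ω | (P.referee.query (P.run σ t ω).1).1 = i} :=
  (measurable_fst.comp (P.referee.measurable_query.comp (P.measurable_run_fst σ t)))
    (measurableSet_singleton i)

lemma measurable_answer (P : LocalProtocol (Fin d → Bool) Q M O n) (σ : P.referee.State)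
    (t : ℕ) (i : Fin n) {m : MeasurableSpace P.Coins} (hm : P.publicInfo σ t ≤ m)
    (h : Measurable[m] fun ω => (P.run σ t ω).2 i) :
    Measurable[m] fun ω => (P.agent i).respond
      ((P.run σ t ω).2 i, (P.referee.query (P.run σ t ω).1).2) :=
  (P.agent i).measurable_respond.comp (h.prodMk (measurable_snd.comp
    (P.referee.measurable_query.comp ((P.measurable_run_fst σ t).mono hm le_rfl))))

/-- Whether and what agent `i` is asked can be read off from the states of the referee; the other
agents act on it only through these. -/
lemma measurable_run_snd (P : LocalProtocol (Fin d → Bool) Q M O n) (σ : P.referee.State)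
    (t : ℕ) (i : Fin n) :
    Measurable[P.ownInfo i ⊔ P.publicInfo σ t] fun ω => (P.run σ t ω).2 i := by
  induction t with
  | zero =>
    exact (measurable_snd.comp (comap_measurable fun ω : P.Coins => ω i)).mono le_sup_left le_rfl
  | succ t ih =>
    have hle : P.publicInfo σ t ≤ P.publicInfo σ (t + 1) := by
      rw [publicInfo_succ]; exact le_sup_left
    have h : (fun ω => (P.run σ (t + 1) ω).2 i) = fun ω =>
        if (P.referee.query (P.run σ t ω).1).1 = i then
          ((P.agent i).respond ((P.run σ t ω).2 i, (P.referee.query (P.run σ t ω).1).2)).2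
        else (P.run σ t ω).2 i := by
      funext ω
      rw [run_succ]
      split_ifs with hi
      · subst hi; simp [step]
      · exact Function.update_of_ne (Ne.symm hi) _ _
    rw [h]
    have ih' := ih.mono (sup_le_sup_left hle (P.ownInfo i)) le_rfl
    refine Measurable.ite ?_ (measurable_snd.comp (P.measurable_answer σ t i ?_ ih')) ih'
    · exact (hle.trans le_sup_right) _ (P.measurable_asked σ t i)
    · exact hle.trans le_sup_right

/-- Given what the referee has seen, agent `i` is independent of the other agents. -/
lemma condIndepGiven_publicInfo (P : LocalProtocol (Fin d → Bool) Q M O n)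
    (σ : P.referee.State) (i : Fin n) (t : ℕ) :
    CondIndepGiven P.coinsLaw (P.ownInfo i ⊔ P.publicInfo σ t)
      (P.othersInfo i ⊔ P.publicInfo σ t) (P.publicInfo σ t) := by
  classical
  induction t with
  | zero =>
    rw [publicInfo_zero, sup_bot_eq, sup_bot_eq]
    exact condIndepGiven_bot (P.ownInfo_le i) (P.othersInfo_le i) (P.indep_ownInfo_othersInfo i)
  | succ t ih =>
    obtain ⟨⟨-, a⟩⟩ : Nonempty ((Fin d → Bool) × (P.agent i).State) :=
      nonempty_of_isProbabilityMeasure (P.coinLaw i)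
    rw [publicInfo_succ]
    -- The message is the new state of the referee, with the old state as the public default. If
    -- agent `i` is not asked, the new state is the same with the state of `i` replaced by the fixed
    -- `a`, hence known to the other side.
    refine ih.message (P.ownInfo_le i) (P.othersInfo_le i) (P.publicInfo_le σ t)
      (P.measurable_asked σ t i) (P.measurable_run_fst σ t)
      (fA := fun ω => P.referee.receive ((P.run σ t ω).1, ((P.agent i).respond
        ((P.run σ t ω).2 i, (P.referee.query (P.run σ t ω).1).2)).1))
      (fB := fun ω => (P.step ((P.run σ t ω).1, Function.update (P.run σ t ω).2 i a)).1)
      ?_ ?_ ?_ ?_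
    · exact P.referee.measurable_receive.comp
        (((P.measurable_run_fst σ t).mono le_sup_right le_rfl).prodMk (measurable_fst.comp
          (P.measurable_answer σ t i le_sup_right (P.measurable_run_snd σ t i))))
    · intro ω hω
      have hω' : (P.referee.query (P.run σ t ω).1).1 = i := hω
      rw [run_succ]
      subst hω'
      rfl
    · refine measurable_fst.comp (P.measurable_step.comp
        (((P.measurable_run_fst σ t).mono le_sup_right le_rfl).prodMk ?_))
      refine @measurable_pi_lambda _ _ _ (P.othersInfo i ⊔ P.publicInfo σ t) _ _ fun j => ?_
      by_cases hj : j = i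
      · subst hj
        simp
      · simp only [Function.update_of_ne hj]
        exact (P.measurable_run_snd σ t j).mono
          (sup_le_sup_right (P.ownInfo_le_othersInfo hj) _) le_rfl
    · intro ω hω
      rw [step_update_of_ne P i _ hω, run_succ]

end LocalProtocol

end

/-! ### Posterior means of the signs, and their bound by privacy. -/

noncomputable section

namespace LocalProtocol

open scoped ENNReal

variable {d n : ℕ} {Q M : Type u} {O : Type w}
  [MeasurableSpace Q] [MeasurableSpace M] [MeasurableSpace O]

lemma measurable_input (P : LocalProtocol (Fin d → Bool) Q M O n) (i : Fin n) :
    Measurable[P.ownInfo i] fun ω : P.Coins => (ω i).1 :=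
  measurable_fst.comp (comap_measurable fun ω : P.Coins => ω i)

lemma stronglyMeasurable_cubeSign_input (P : LocalProtocol (Fin d → Bool) Q M O n)
    (k : Fin d) (i : Fin n) :
    StronglyMeasurable[P.ownInfo i] fun ω : P.Coins => cubeSign k (ω i).1 :=
  ((measurable_of_finite (cubeSign k)).comp (P.measurable_input i)).stronglyMeasurable

/-- The conditional expectation of the `k`-th sign of the input of agent `i`, given what the referee
has seen. -/
lemma exists_posterior (P : LocalProtocol (Fin d → Bool) Q M O n) (σ : P.referee.State) (t : ℕ)
    (i : Fin n) (k : Fin d) :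
    ∃ b : P.Coins → ℝ, StronglyMeasurable[P.publicInfo σ t] b ∧ (∀ ω, |b ω| ≤ 1) ∧
      ∀ F : P.Coins → ℝ, StronglyMeasurable[P.othersInfo i ⊔ P.publicInfo σ t] F →
        ∀ C : ℝ, (∀ ω, ‖F ω‖ ≤ C) →
          ∫ ω, cubeSign k (ω i).1 * F ω ∂P.coinsLaw = ∫ ω, b ω * F ω ∂P.coinsLaw := by
  have hA := sup_le (P.ownInfo_le i) (P.publicInfo_le σ t)
  have hB := sup_le (P.othersInfo_le i) (P.publicInfo_le σ t)
  -- Nothing new is disclosed; this only exchanges the two sides.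
  have hci := (P.condIndepGiven_publicInfo σ i t).disclose hA hB le_rfl le_sup_right
  rw [sup_assoc, sup_idem] at hci
  set V : Set P.Coins := {ω | (ω i).1 k = true} with hVdef
  have hV : MeasurableSet[P.ownInfo i ⊔ P.publicInfo σ t] V := by
    refine le_sup_left (a := P.ownInfo i) _ ?_
    exact (P.measurable_input i) (t := {x | x k = true}) (Set.toFinite _).measurableSet
  obtain ⟨p, hpm, hp, hpF⟩ := hci.exists_condProb hA hB hV
  -- A sign is twice the indicator of its bit minus 1.
  refine ⟨fun ω => 2 * p ω - 1, (stronglyMeasurable_const.mul hpm).sub stronglyMeasurable_const,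
    fun ω => abs_le.2 ⟨by linarith [(hp ω).1], by linarith [(hp ω).2]⟩, fun F hF C hC => ?_⟩
  have hFi : Integrable F P.coinsLaw :=
    Integrable.of_bound (hF.mono hB).aestronglyMeasurable _ (Filter.Eventually.of_forall hC)
  have h1 : Integrable (fun ω => V.indicator 1 ω * F ω) P.coinsLaw := by
    refine hFi.bdd_mul (c := 1)
      (stronglyMeasurable_one.indicator (hA V hV)).aestronglyMeasurable
      (Filter.Eventually.of_forall fun ω => ?_)
    by_cases h : ω ∈ V <;> simp [h]
  have h2 : Integrable (fun ω => p ω * F ω) P.coinsLaw := by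
    refine hFi.bdd_mul (c := 1) (hpm.mono (P.publicInfo_le σ t)).aestronglyMeasurable
      (Filter.Eventually.of_forall fun ω => ?_)
    rw [Real.norm_eq_abs, abs_of_nonneg (hp ω).1]
    exact (hp ω).2
  calc ∫ ω, cubeSign k (ω i).1 * F ω ∂P.coinsLaw
      = ∫ ω, 2 * (V.indicator 1 ω * F ω) - F ω ∂P.coinsLaw := by
        congr 1 with ω
        by_cases h : (ω i).1 k = true
        · have : ω ∈ V := h
          simp [cubeSign, h, this]; ring
        · have : ω ∉ V := h
          simp [cubeSign, h, this]
    _ = ∫ ω, 2 * (p ω * F ω) - F ω ∂P.coinsLaw := by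
        rw [integral_sub (h1.const_mul 2) hFi, integral_sub (h2.const_mul 2) hFi,
          integral_const_mul, integral_const_mul, hpF F hF C hC]
    _ = _ := by
        congr 1 with ω
        ring

/-- The histories of length `N` in which agent `i` was asked. -/
def askedHistories (P : LocalProtocol (Fin d → Bool) Q M O n) (N : ℕ) (i : Fin n) :
    Set (ℕ → P.referee.State) :=
  -- Entry 0 is the final state, whose query is never sent; entries 1 to `N` are the states from
  -- which the `N` queries were made.
  {h | ∃ l ∈ Finset.Icc 1 N, (P.referee.query (h l)).1 = i}

lemma measurableSet_askedHistories (P : LocalProtocol (Fin d → Bool) Q M O n) (N : ℕ)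
    (i : Fin n) : MeasurableSet (P.askedHistories N i) := by
  have : P.askedHistories N i =
      ⋃ l ∈ Finset.Icc 1 N, {h | (P.referee.query (h l)).1 = i} := by
    ext h; simp [askedHistories]
  rw [this]
  exact Finset.measurableSet_biUnion _ fun l _ =>
    (measurable_fst.comp (P.referee.measurable_query.comp (measurable_pi_apply l)))
      (measurableSet_singleton i)

lemma sum_indicator_askedHistories_le (P : LocalProtocol (Fin d → Bool) Q M O n) (N : ℕ)
    (h : ℕ → P.referee.State) :
    ∑ i, (P.askedHistories N i).indicator (1 : (ℕ → P.referee.State) → ℝ) h ≤ N := by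
  classical
  have hcard : (Finset.univ.filter fun i => h ∈ P.askedHistories N i).card ≤ N := by
    have hsub : (Finset.univ.filter fun i => h ∈ P.askedHistories N i) ⊆
        (Finset.Icc 1 N).image fun l => (P.referee.query (h l)).1 := by
      intro i hi
      obtain ⟨l, hl, rfl⟩ := (Finset.mem_filter.1 hi).2
      exact Finset.mem_image_of_mem _ hl
    exact (Finset.card_le_card hsub).trans (Finset.card_image_le.trans (by simp))
  simp only [Set.indicator_apply, Pi.one_apply, Finset.sum_boole]
  exact_mod_cast hcard

/-- An agent that is never asked has no influence on the history. -/
lemma history_update_of_not_asked (P : LocalProtocol (Fin d → Bool) Q M O n) (N : ℕ)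
    (i : Fin n) (c : P.Config) (hc : P.history N c ∉ P.askedHistories N i)
    (a : (P.agent i).State) : P.history N (c.1, Function.update c.2 i a) = P.history N c := by
  have hstep : ∀ t ≤ N, P.step^[t] (c.1, Function.update c.2 i a) =
      ((P.step^[t] c).1, Function.update (P.step^[t] c).2 i a) := by
    intro t
    induction t with
    | zero => intro _; rfl
    | succ t ih =>
      intro ht
      rw [Function.iterate_succ_apply', ih (by omega), Function.iterate_succ_apply']
      refine P.step_update_of_ne i _ (fun hq => hc ⟨N - t, ?_, ?_⟩) a
      · simp only [Finset.mem_Icc]; omega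
      · simp only [history]
        rwa [show N - (N - t) = t by omega]
  funext l
  simp only [history, hstep (N - l) (Nat.sub_le _ _)]

/-- The replacement is undone by putting the old state back, so the preceding lemma applies in both
directions. -/
lemma history_update_mem_asked_iff (P : LocalProtocol (Fin d → Bool) Q M O n) (N : ℕ)
    (i : Fin n) (c : P.Config) (a : (P.agent i).State) :
    P.history N (c.1, Function.update c.2 i a) ∈ P.askedHistories N i ↔
      P.history N c ∈ P.askedHistories N i := by
  constructor
  · contrapose
    intro h
    rwa [P.history_update_of_not_asked N i c h a]
  · contrapose
    intro h
    have := P.history_update_of_not_asked N i _ h (c.2 i)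
    simp only [Function.update_idem, Function.update_eq_self, Prod.mk.eta] at this
    rwa [this]

lemma initial_update (P : LocalProtocol (Fin d → Bool) Q M O n) (ω : P.Coins) (i : Fin n)
    (p : (Fin d → Bool) × (P.agent i).State) :
    (fun j => (Function.update ω i p j).2) = Function.update (fun j => (ω j).2) i p.2 := by
  funext j
  by_cases h : j = i
  · subst h; simp
  · simp [h]

lemma integral_cubeSign_input (P : LocalProtocol (Fin d → Bool) Q M O n) (i : Fin n)
    (k : Fin d) : ∫ ω, cubeSign k (ω i).1 ∂P.coinsLaw = 0 := by
  have h1 : ∫ ω, cubeSign k (ω i).1 ∂P.coinsLaw = ∫ p, cubeSign k p.1 ∂P.coinLaw i := by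
    have hmp := measurePreserving_eval P.coinLaw i
    rw [← hmp.map_eq, integral_map hmp.measurable.aemeasurable]
    · rfl
    · exact ((measurable_of_finite (cubeSign k)).comp measurable_fst).aestronglyMeasurable
  have hint : ∀ x, Integrable (fun p : (Fin d → Bool) × (P.agent i).State => cubeSign k p.1)
      (((P.agent i).start x).map (Prod.mk x)) := fun x =>
    Integrable.of_bound ((measurable_of_finite (cubeSign k)).comp
      measurable_fst).aestronglyMeasurable 1
      (Filter.Eventually.of_forall fun p => (abs_cubeSign k p.1).le)
  have hcoin : P.coinLaw i =
      ∑ x, ((2 : ℝ≥0∞) ^ d)⁻¹ • ((P.agent i).start x).map (Prod.mk x) := rfl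
  rw [h1, hcoin, integral_finsetSum_measure fun x _ => (hint x).smul_measure (by simp)]
  have h2 : ∀ x, ∫ p, cubeSign k p.1 ∂(((2 : ℝ≥0∞) ^ d)⁻¹ •
      ((P.agent i).start x).map (Prod.mk x)) = (((2 : ℝ≥0∞) ^ d)⁻¹).toReal * cubeSign k x := by
    intro x
    rw [integral_smul_measure, integral_map measurable_prodMk_left.aemeasurable
      (hint x).aestronglyMeasurable]
    simp
  simp_rw [h2, ← Finset.mul_sum, sum_cubeSign, mul_zero]

/-- Where agent `i` is not asked, the history carries no information on its input. -/
lemma integral_cubeSign_mul_not_asked (P : LocalProtocol (Fin d → Bool) Q M O n)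
    (σ : P.referee.State) (N : ℕ) (i : Fin n) (k : Fin d) {c : (ℕ → P.referee.State) → ℝ}
    (hc : Measurable c) {C : ℝ} (hC : ∀ h, |c h| ≤ C) :
    ∫ ω, cubeSign k (ω i).1 *
      (P.askedHistories N i)ᶜ.indicator c (P.transcript σ N ω) ∂P.coinsLaw = 0 := by
  obtain ⟨p⟩ : Nonempty ((Fin d → Bool) × (P.agent i).State) :=
    nonempty_of_isProbabilityMeasure (P.coinLaw i)
  set F : P.Coins → ℝ := fun ω => (P.askedHistories N i)ᶜ.indicator c (P.transcript σ N ω)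
    with hF
  have hFm : Measurable F :=
    (hc.indicator (P.measurableSet_askedHistories N i).compl).comp (P.measurable_transcript σ N)
  -- `F` ignores coordinate `i`, so it is a function of the other agents' coins and independent of
  -- the centred sign of `i`.
  have hinv : ∀ ω, F (Function.update ω i p) = F ω := by
    intro ω
    simp only [hF, transcript, initial_update]
    have hiff := P.history_update_mem_asked_iff N i (σ, fun j => (ω j).2) p.2
    by_cases h : P.history N (σ, fun j => (ω j).2) ∈ P.askedHistories N i
    · simp only at hiff
      rw [Set.indicator_of_notMem (by simpa using hiff.2 h),
        Set.indicator_of_notMem (by simpa using h)]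
    · have := P.history_update_of_not_asked N i _ h p.2
      simp only at this
      rw [this]
  have hupd : Measurable[P.othersInfo i] fun ω : P.Coins => Function.update ω i p := by
    refine @measurable_pi_lambda _ _ _ (P.othersInfo i) _ _ fun j => ?_
    by_cases hj : j = i
    · subst hj
      simp
    · simp only [Function.update_of_ne hj]
      exact (comap_measurable fun ω : P.Coins => ω j).mono (P.ownInfo_le_othersInfo hj) le_rfl
  have hFo : StronglyMeasurable[P.othersInfo i] F := by
    have := (hFm.comp hupd).stronglyMeasurable
    rwa [show F ∘ (fun ω : P.Coins => Function.update ω i p) = F from funext hinv] at this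
  have hFC : ∀ ω, ‖F ω‖ ≤ C := fun ω => (norm_indicator_le_norm_self _ _).trans (hC _)
  have hs := P.stronglyMeasurable_cubeSign_input k i
  have hsi : Integrable (fun ω : P.Coins => cubeSign k (ω i).1) P.coinsLaw :=
    Integrable.of_bound (hs.mono (P.ownInfo_le i)).aestronglyMeasurable 1
      (Filter.Eventually.of_forall fun ω => (abs_cubeSign k _).le)
  rw [integral_condExp_mul P.coinsLaw (P.othersInfo_le i) hsi hFo
    (Filter.Eventually.of_forall hFC)]
  have hce := condExp_indep_eq (P.ownInfo_le i) (P.othersInfo_le i) hs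
    (P.indep_ownInfo_othersInfo i)
  rw [P.integral_cubeSign_input i k] at hce
  rw [integral_congr_ae (g := fun _ => (0 : ℝ)), integral_zero]
  filter_upwards [hce] with ω hω
  rw [hω, zero_mul]

/-- By privacy, the input of agent `i` may be replaced by an independent uniform one. -/
lemma lintegral_transcript_input_le (P : LocalProtocol (Fin d → Bool) Q M O n) {ε : ℝ}
    (hP : P.IsDP ε 0) (σ : P.referee.State) (N : ℕ) (i : Fin n)
    {Φ : (ℕ → P.referee.State) → (Fin d → Bool) → ℝ≥0∞} (hΦ : ∀ x, Measurable fun h => Φ h x) :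
    ∫⁻ ω, Φ (P.transcript σ N ω) (ω i).1 ∂P.coinsLaw ≤
      ∫⁻ ω, ENNReal.ofReal (Real.exp ε) *
        ∑ x, ((2 : ℝ≥0∞) ^ d)⁻¹ * Φ (P.transcript σ N ω) x ∂P.coinsLaw := by
  have hΦ' : Measurable fun q : (ℕ → P.referee.State) × (Fin d → Bool) => Φ q.1 q.2 :=
    measurable_from_prod_countable_left hΦ
  have hmt := P.measurable_transcript σ N
  have hsum : Measurable fun h => ENNReal.ofReal (Real.exp ε) *
      ∑ x, ((2 : ℝ≥0∞) ^ d)⁻¹ * Φ h x :=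
    (Finset.measurable_fun_sum _ fun x _ => (hΦ x).const_mul _).const_mul _
  -- It suffices to integrate over agent `i` with all other coordinates fixed, which is the setting
  -- of `IsDP.history`.
  refine lintegral_le_of_lmarginal_le {i}
    (f := fun ω : P.Coins => Φ (P.transcript σ N ω) (ω i).1)
    (g := fun ω : P.Coins => ENNReal.ofReal (Real.exp ε) *
        ∑ x, ((2 : ℝ≥0∞) ^ d)⁻¹ * Φ (P.transcript σ N ω) x)
    (hΦ'.comp (hmt.prodMk (measurable_fst.comp (measurable_pi_apply i))))
    (hsum.comp hmt) ?_
  rw [lmarginal_singleton, lmarginal_singleton]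
  intro ω
  set s : ∀ j, (P.agent j).State := fun j => (ω j).2
  set H : (P.agent i).State → ℕ → P.referee.State :=
    fun a => P.history N (σ, Function.update s i a) with hH
  have hHm : Measurable H :=
    (P.measurable_history N).comp (measurable_const.prodMk (measurable_update s))
  have htr : ∀ p, P.transcript σ N (Function.update ω i p) = H p.2 := fun p => by
    simp only [transcript, initial_update, hH, s]
  simp only [htr, Function.update_self]
  have hHs : Measurable fun p : (Fin d → Bool) × (P.agent i).State => H p.2 :=
    hHm.comp measurable_snd
  rw [P.lintegral_coinLaw i (f := fun p => Φ (H p.2) p.1) (hΦ'.comp (hHs.prodMk measurable_fst)),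
    P.lintegral_coinLaw i (f := fun p => ENNReal.ofReal (Real.exp ε) *
      ∑ x, ((2 : ℝ≥0∞) ^ d)⁻¹ * Φ (H p.2) x) (hsum.comp hHs)]
  have hdp : ∀ x x', ∫⁻ a, Φ (H a) x ∂(P.agent i).start x ≤
      ENNReal.ofReal (Real.exp ε) * ∫⁻ a, Φ (H a) x ∂(P.agent i).start x' := by
    intro x x'
    have hle : ((P.agent i).start x).map H ≤
        ENNReal.ofReal (Real.exp ε) • ((P.agent i).start x').map H := by
      refine Measure.le_iff.2 fun T hT => ?_
      rw [Measure.smul_apply, Measure.map_apply hHm hT, Measure.map_apply hHm hT, smul_eq_mul]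
      exact hP.history i N σ s x x' hT
    have := lintegral_mono' hle (le_refl fun h => Φ h x)
    rwa [lintegral_smul_measure, lintegral_map (hΦ x) hHm, lintegral_map (hΦ x) hHm,
      smul_eq_mul] at this
  have hrhs : ∀ x', ∫⁻ a, ENNReal.ofReal (Real.exp ε) *
      ∑ x, ((2 : ℝ≥0∞) ^ d)⁻¹ * Φ (H a) x ∂(P.agent i).start x' =
      ∑ x, ((2 : ℝ≥0∞) ^ d)⁻¹ *
        (ENNReal.ofReal (Real.exp ε) * ∫⁻ a, Φ (H a) x ∂(P.agent i).start x') := by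
    intro x'
    have hm : ∀ x, Measurable fun a => Φ (H a) x := fun x => (hΦ x).comp hHm
    rw [lintegral_const_mul _ (Finset.measurable_fun_sum _ fun x _ => (hm x).const_mul _),
      lintegral_finsetSum _ fun x _ => (hm x).const_mul _, Finset.mul_sum]
    refine Finset.sum_congr rfl fun x _ => ?_
    rw [lintegral_const_mul _ (hm x)]
    ring
  simp only [hrhs]
  -- The true input `x` is compared with every `x'` and the result is averaged over `x'`: the run
  -- now uses `x'`, while `x` survives only as an independent uniform argument of `Φ`.
  calc ∑ x, ((2 : ℝ≥0∞) ^ d)⁻¹ * ∫⁻ a, Φ (H a) x ∂(P.agent i).start x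
      = ∑ x' : Fin d → Bool, ((2 : ℝ≥0∞) ^ d)⁻¹ *
          ∑ x, ((2 : ℝ≥0∞) ^ d)⁻¹ * ∫⁻ a, Φ (H a) x ∂(P.agent i).start x := by
        rw [← Finset.sum_mul, sum_inv_two_pow, one_mul]
    _ ≤ _ := by
        gcongr with x' _ x _
        exact hdp x x'

/-- Once the input is replaced by an independent uniform point, the signs `c k` are constants for
each history, and `sum_abs_signed_cubeSign_le` applies. The absolute value is needed because the
replacement is valid only for nonnegative functions. -/
lemma integral_asked_abs_le (P : LocalProtocol (Fin d → Bool) Q M O n) {ε : ℝ}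
    (hP : P.IsDP ε 0) (σ : P.referee.State) (N : ℕ) (i : Fin n)
    {c : Fin d → (ℕ → P.referee.State) → ℝ} (hc : ∀ k, Measurable (c k))
    (hc1 : ∀ k h, |c k h| = 1) :
    ∫ ω, (P.askedHistories N i).indicator 1 (P.transcript σ N ω) *
        |∑ k, c k (P.transcript σ N ω) * cubeSign k (ω i).1| ∂P.coinsLaw ≤
      Real.exp ε * √d *
        ∫ ω, (P.askedHistories N i).indicator 1 (P.transcript σ N ω) ∂P.coinsLaw := by
  set W := P.askedHistories N i with hW
  have hWm : MeasurableSet W := P.measurableSet_askedHistories N i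
  have hmt := P.measurable_transcript σ N
  set Φ : (ℕ → P.referee.State) → (Fin d → Bool) → ℝ :=
    fun h x => W.indicator 1 h * |∑ k, c k h * cubeSign k x| with hΦ
  have hind : Measurable fun h => W.indicator (1 : (ℕ → P.referee.State) → ℝ) h :=
    measurable_one.indicator hWm
  have hind0 : ∀ h, 0 ≤ W.indicator (1 : (ℕ → P.referee.State) → ℝ) h := fun h =>
    Set.indicator_nonneg (fun _ _ => zero_le_one) h
  have hΦm : ∀ x, Measurable fun h => Φ h x := fun x =>
    hind.mul (continuous_abs.measurable.comp
      (Finset.measurable_fun_sum _ fun k _ => (hc k).mul_const _))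
  have hΦ0 : ∀ h x, 0 ≤ Φ h x := fun h x => mul_nonneg (hind0 h) (abs_nonneg _)
  have hΦ' : Measurable fun q : (ℕ → P.referee.State) × (Fin d → Bool) => Φ q.1 q.2 :=
    measurable_from_prod_countable_left hΦm
  have hle := P.lintegral_transcript_input_le hP σ N i
    (Φ := fun h x => ENNReal.ofReal (Φ h x)) fun x => (hΦm x).ennreal_ofReal
  have hpt : ∀ h, ENNReal.ofReal (Real.exp ε) * ∑ x, ((2 : ℝ≥0∞) ^ d)⁻¹ *
      ENNReal.ofReal (Φ h x) ≤ ENNReal.ofReal (Real.exp ε * √d * W.indicator 1 h) := by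
    intro h
    have h2 : ((2 : ℝ≥0∞) ^ d)⁻¹ = ENNReal.ofReal ((2 ^ d)⁻¹) := by
      rw [ENNReal.ofReal_inv_of_pos (by positivity), ENNReal.ofReal_pow (by norm_num)]
      simp
    rw [h2, ← Finset.mul_sum, ← ENNReal.ofReal_sum_of_nonneg fun x _ => hΦ0 h x,
      ← ENNReal.ofReal_mul (by positivity), ← ENNReal.ofReal_mul (by positivity)]
    refine ENNReal.ofReal_le_ofReal ?_
    rw [mul_assoc]
    refine mul_le_mul_of_nonneg_left ?_ (Real.exp_pos ε).le
    simp only [hΦ]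
    rw [← Finset.mul_sum, mul_left_comm, mul_comm (√(d : ℝ))]
    refine mul_le_mul_of_nonneg_left ?_ (hind0 h)
    rw [inv_mul_le_iff₀ (by positivity)]
    exact sum_abs_signed_cubeSign_le (fun k => c k h) fun k => hc1 k h
  have hle' := hle.trans (lintegral_mono fun ω => hpt (P.transcript σ N ω))
  have hint : Integrable (fun ω => Real.exp ε * √d * W.indicator 1 (P.transcript σ N ω))
      P.coinsLaw := by
    refine (Integrable.of_bound (hind.comp hmt).aestronglyMeasurable 1
      (Filter.Eventually.of_forall fun ω => ?_)).const_mul _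
    simp only [Function.comp_apply]
    by_cases h : P.transcript σ N ω ∈ W <;> simp [h]
  rw [← integral_const_mul]
  rw [integral_eq_lintegral_of_nonneg_ae, integral_eq_lintegral_of_nonneg_ae]
  · refine ENNReal.toReal_mono ?_ hle'
    exact hint.lintegral_lt_top.ne
  · exact Filter.Eventually.of_forall fun ω =>
      mul_nonneg (by positivity) (hind0 _)
  · exact hint.aestronglyMeasurable
  · exact Filter.Eventually.of_forall fun ω => hΦ0 _ _
  · exact (hΦ'.comp (hmt.prodMk
      (measurable_fst.comp (measurable_pi_apply i)))).aestronglyMeasurable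

/-- The total information on the input of agent `i` is small, and there is none unless agent `i` is
asked. -/
lemma sum_integral_abs_posterior_le (P : LocalProtocol (Fin d → Bool) Q M O n) {ε : ℝ}
    (hP : P.IsDP ε 0) (σ : P.referee.State) (N : ℕ) (i : Fin n) {b : Fin d → P.Coins → ℝ}
    (hb : ∀ k, StronglyMeasurable[P.publicInfo σ N] (b k))
    (hrep : ∀ k (F : P.Coins → ℝ), StronglyMeasurable[P.othersInfo i ⊔ P.publicInfo σ N] F →
      ∀ C : ℝ, (∀ ω, ‖F ω‖ ≤ C) →
        ∫ ω, cubeSign k (ω i).1 * F ω ∂P.coinsLaw = ∫ ω, b k ω * F ω ∂P.coinsLaw) :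
    ∑ k, ∫ ω, |b k ω| ∂P.coinsLaw ≤ Real.exp ε * √d *
      ∫ ω, (P.askedHistories N i).indicator 1 (P.transcript σ N ω) ∂P.coinsLaw := by
  classical
  -- The sign of `b k` must be a function of the history, not merely of the coins, for the privacy
  -- bound to apply to it.
  have hV : ∀ k, ∃ V : Set (ℕ → P.referee.State), MeasurableSet V ∧
      P.transcript σ N ⁻¹' V = {ω | 0 ≤ b k ω} := fun k =>
    (hb k).measurable measurableSet_Ici
  choose V hVm hVb using hV
  set c : Fin d → (ℕ → P.referee.State) → ℝ := fun k h => if h ∈ V k then 1 else -1 with hc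
  have hcm : ∀ k, Measurable (c k) := fun k =>
    Measurable.ite (hVm k) measurable_const measurable_const
  have hc1 : ∀ k h, |c k h| = 1 := fun k h => by
    simp only [hc]; split_ifs <;> simp
  have hcb : ∀ k ω, |b k ω| = b k ω * c k (P.transcript σ N ω) := by
    intro k ω
    have hiff : P.transcript σ N ω ∈ V k ↔ 0 ≤ b k ω := by
      have : ω ∈ P.transcript σ N ⁻¹' V k ↔ ω ∈ {ω | 0 ≤ b k ω} := by rw [hVb k]
      exact this
    simp only [hc, hiff]
    split_ifs with h
    · rw [abs_of_nonneg h, mul_one]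
    · rw [abs_of_neg (not_le.1 h)]; ring
  set W := P.askedHistories N i
  have hWm : MeasurableSet W := P.measurableSet_askedHistories N i
  have hmt := P.measurable_transcript σ N
  have hcu : ∀ k, StronglyMeasurable[P.othersInfo i ⊔ P.publicInfo σ N]
      fun ω => c k (P.transcript σ N ω) := fun k =>
    (((hcm k).comp (comap_measurable (P.transcript σ N))).stronglyMeasurable).mono le_sup_right
  have hsm : ∀ k, Measurable fun ω : P.Coins => cubeSign k (ω i).1 := fun k =>
    (measurable_of_finite (cubeSign k)).comp (measurable_fst.comp (measurable_pi_apply i))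
  have hbd : ∀ (S : Set (ℕ → P.referee.State)) k (ω : P.Coins),
      ‖cubeSign k (ω i).1 * S.indicator (c k) (P.transcript σ N ω)‖ ≤ 1 := by
    intro S k ω
    rw [norm_mul, Real.norm_eq_abs, abs_cubeSign, one_mul]
    exact (norm_indicator_le_norm_self _ _).trans (hc1 k _).le
  have hi : ∀ (S : Set (ℕ → P.referee.State)) (_ : MeasurableSet S) k, Integrable
      (fun ω : P.Coins => cubeSign k (ω i).1 * S.indicator (c k) (P.transcript σ N ω))
      P.coinsLaw := fun S hS k =>
    Integrable.of_bound ((hsm k).mul (((hcm k).indicator hS).comp hmt)).aestronglyMeasurable 1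
      (Filter.Eventually.of_forall (hbd S k))
  -- Write `|b k|` as `b k` times its sign, return from the posterior mean to the input itself, and
  -- drop the histories in which agent `i` is not asked.
  have hk : ∀ k, ∫ ω, |b k ω| ∂P.coinsLaw =
      ∫ ω, cubeSign k (ω i).1 * W.indicator (c k) (P.transcript σ N ω) ∂P.coinsLaw := by
    intro k
    simp_rw [hcb k]
    rw [← hrep k _ (hcu k) 1 fun ω => (hc1 k _).le]
    have hsplit : ∀ ω : P.Coins, cubeSign k (ω i).1 * c k (P.transcript σ N ω) =
        cubeSign k (ω i).1 * W.indicator (c k) (P.transcript σ N ω) +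
        cubeSign k (ω i).1 * Wᶜ.indicator (c k) (P.transcript σ N ω) := fun ω => by
      by_cases h : P.transcript σ N ω ∈ W <;> simp [h]
    simp_rw [hsplit]
    rw [integral_add (hi W hWm k) (hi Wᶜ hWm.compl k),
      P.integral_cubeSign_mul_not_asked σ N i k (hcm k) fun h => (hc1 k h).le, add_zero]
  simp_rw [hk]
  rw [← integral_finsetSum _ fun k _ => hi W hWm k]
  have hint := integrable_finsetSum Finset.univ fun k _ => hi W hWm k
  refine (integral_mono hint hint.abs fun ω => le_abs_self _).trans ?_
  refine le_of_eq_of_le (integral_congr_ae (Filter.Eventually.of_forall fun ω => ?_))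
    (P.integral_asked_abs_le hP σ N i hcm hc1)
  by_cases h : P.transcript σ N ω ∈ W
  · simp [W, h, mul_comm]
  · simp [W, h]

end LocalProtocol

end

/-! ### Lower bound on the total failure probability. -/

noncomputable section

namespace LocalProtocol

open scoped ENNReal

variable {d n : ℕ} {Q M : Type u} {O : Type w}
  [MeasurableSpace Q] [MeasurableSpace M] [MeasurableSpace O]

/-- Splitting by input vectors links the conditional independence argument, where inputs are random
coordinates, with `outcome`, where they are fixed. -/
lemma coinsLaw_eq_sum (P : LocalProtocol (Fin d → Bool) Q M O n) :
    P.coinsLaw = ∑ Y : Fin n → Fin d → Bool, (((2 : ℝ≥0∞) ^ d)⁻¹) ^ n •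
      (Measure.pi fun i => (P.agent i).start (Y i)).map fun s i => (Y i, s i) := by
  refine Measure.pi_eq fun R hR => ?_
  have hm : ∀ Y : Fin n → Fin d → Bool, Measurable
      fun (s : ∀ i, (P.agent i).State) (i : Fin n) => (Y i, s i) := fun Y =>
    measurable_pi_lambda _ fun i => measurable_const.prodMk (measurable_pi_apply i)
  have h1 : ∀ i, P.coinLaw i (R i) = ∑ x, ((2 : ℝ≥0∞) ^ d)⁻¹ *
      (P.agent i).start x (Prod.mk x ⁻¹' R i) := fun i => by
    rw [coinLaw, Measure.finsetSum_apply]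
    refine Finset.sum_congr rfl fun x _ => ?_
    rw [Measure.smul_apply, Measure.map_apply measurable_prodMk_left (hR i), smul_eq_mul]
  simp_rw [h1]
  rw [Finset.prod_univ_sum, Fintype.piFinset_univ, Measure.finsetSum_apply]
  refine Finset.sum_congr rfl fun Y _ => ?_
  rw [Measure.smul_apply, Measure.map_apply (hm Y) (MeasurableSet.univ_pi hR), smul_eq_mul,
    Finset.prod_mul_distrib]
  have hpre : (fun (s : ∀ i, (P.agent i).State) (i : Fin n) => (Y i, s i)) ⁻¹'
      Set.univ.pi R = Set.univ.pi fun i => Prod.mk (Y i) ⁻¹' R i := by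
    ext s; simp
  rw [hpre, Measure.pi_pi]
  simp

lemma integral_coinsLaw (P : LocalProtocol (Fin d → Bool) Q M O n) {f : P.Coins → ℝ}
    (hf : Measurable f) {C : ℝ} (hC : ∀ ω, |f ω| ≤ C) :
    ∫ ω, f ω ∂P.coinsLaw = ∑ Y : Fin n → Fin d → Bool, (((2 : ℝ) ^ d)⁻¹) ^ n *
      ∫ s, f (fun i => (Y i, s i)) ∂(Measure.pi fun i => (P.agent i).start (Y i)) := by
  have hm : ∀ Y : Fin n → Fin d → Bool, Measurable
      fun (s : ∀ i, (P.agent i).State) (i : Fin n) => (Y i, s i) := fun Y =>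
    measurable_pi_lambda _ fun i => measurable_const.prodMk (measurable_pi_apply i)
  rw [coinsLaw_eq_sum, integral_finsetSum_measure]
  · refine Finset.sum_congr rfl fun Y _ => ?_
    rw [integral_smul_measure, integral_map (hm Y).aemeasurable hf.aestronglyMeasurable]
    simp
  · intro Y _
    have : IsProbabilityMeasure ((Measure.pi fun i => (P.agent i).start (Y i)).map
        fun (s : ∀ i, (P.agent i).State) (i : Fin n) => (Y i, s i)) :=
      Measure.isProbabilityMeasure_map (hm Y).aemeasurable
    refine (Integrable.of_bound hf.aestronglyMeasurable C
      (Filter.Eventually.of_forall hC)).smul_measure ?_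
    exact ENNReal.pow_ne_top (by simp)

/-- If the referee starts in `σ` and the inputs are uniform subject to the `k`-th bit being set, then
for an average `k` the output differs from `k` with large probability. -/
lemma le_sum_integral_wrong (P : LocalProtocol (Fin d → Bool) Q M (Fin d) n) {ε : ℝ}
    (hP : P.IsDP ε 0) (σ : P.referee.State) :
    d - 1 - Real.exp ε * √d * P.messages ≤
      ∑ k, ∫ ω, ({k}ᶜ : Set (Fin d)).indicator 1 (P.referee.output (P.run σ P.messages ω).1) *
        ∏ i, (1 + cubeSign k (ω i).1) ∂P.coinsLaw := by
  set N := P.messages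
  choose b hbm hb1 hrep using P.exists_posterior σ N
  set g : Fin d → P.Coins → ℝ := fun k ω =>
    ({k}ᶜ : Set (Fin d)).indicator 1 (P.referee.output (P.run σ N ω).1) with hg
  have hgm : ∀ k, StronglyMeasurable[P.publicInfo σ N] (g k) := fun k =>
    ((measurable_of_finite (({k}ᶜ : Set (Fin d)).indicator (1 : Fin d → ℝ))).comp (P.referee.measurable_output.comp
      (P.measurable_run_fst σ N))).stronglyMeasurable
  have hg0 : ∀ k ω, 0 ≤ g k ω := fun k ω => Set.indicator_nonneg (fun _ _ => zero_le_one) _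
  have hg1 : ∀ k ω, g k ω ≤ 1 := fun k ω =>
    Set.indicator_le_self' (f := (1 : Fin d → ℝ)) (fun _ _ => zero_le_one) _
  have hgabs : ∀ k ω, |g k ω| ≤ 1 := fun k ω => by
    rw [abs_of_nonneg (hg0 k ω)]; exact hg1 k ω
  have hGle := P.publicInfo_le σ N
  have hgi : ∀ k, Integrable (g k) P.coinsLaw := fun k =>
    Integrable.of_bound ((hgm k).mono hGle).aestronglyMeasurable 1
      (Filter.Eventually.of_forall (hgabs k))
  have hbi : ∀ i k, Integrable (fun ω => |b i k ω|) P.coinsLaw := fun i k =>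
    (Integrable.of_bound ((hbm i k).mono hGle).aestronglyMeasurable 1
      (Filter.Eventually.of_forall (hb1 i k))).abs
  -- The failure event is a function of the transcript, so posterior means may replace the signs;
  -- then the product is bounded below using `0 ≤ g k ≤ 1`.
  have hone : ∀ k, ∫ ω, g k ω ∂P.coinsLaw - ∑ i, ∫ ω, |b i k ω| ∂P.coinsLaw ≤
      ∫ ω, g k ω * ∏ i, (1 + cubeSign k (ω i).1) ∂P.coinsLaw := by
    intro k
    rw [integral_prod_one_add_replace (G := P.publicInfo σ N)
      (B := fun i => P.othersInfo i ⊔ P.publicInfo σ N) (f := fun i ω => cubeSign k (ω i).1)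
      (b := fun i => b i k) (fun i => le_sup_right) (fun i => sup_le (P.othersInfo_le i) hGle)
      (fun i => (P.stronglyMeasurable_cubeSign_input k i).mono (P.ownInfo_le i))
      (fun i j hj => (P.stronglyMeasurable_cubeSign_input k j).mono
        ((P.ownInfo_le_othersInfo hj).trans le_sup_left))
      (fun i => hbm i k) (fun i ω => (abs_cubeSign k _).le) (fun i => hb1 i k)
      (fun i => hrep i k) (hgm k) (hgabs k),
      ← integral_finsetSum _ fun i _ => hbi i k,
      ← integral_sub (hgi k) (integrable_finsetSum _ fun i _ => hbi i k)]
    refine integral_mono ((hgi k).sub (integrable_finsetSum _ fun i _ => hbi i k)) ?_ fun ω => ?_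
    · have hm : StronglyMeasurable fun ω => ∏ i, (1 + b i k ω) :=
        Finset.stronglyMeasurable_fun_prod _ fun i _ =>
          stronglyMeasurable_const.add ((hbm i k).mono hGle)
      refine (hgi k).mul_bdd (c := 2 ^ n) hm.aestronglyMeasurable
        (Filter.Eventually.of_forall fun ω => ?_)
      rw [Real.norm_eq_abs, Finset.abs_prod]
      refine (Finset.prod_le_prod (fun _ _ => abs_nonneg _) fun i _ =>
        (abs_add_le 1 (b i k ω)).trans (?_ : _ ≤ (2 : ℝ))).trans_eq (by simp)
      rw [abs_one]
      linarith [hb1 i k ω]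
    · have h1 := mul_le_mul_of_nonneg_left
        (one_sub_sum_abs_le_prod Finset.univ (fun i => b i k ω) fun i => hb1 i k ω) (hg0 k ω)
      have h2 : 0 ≤ ∑ i, |b i k ω| := Finset.sum_nonneg fun i _ => abs_nonneg _
      have h3 := mul_le_mul_of_nonneg_right (hg1 k ω) h2
      simp only at h1 ⊢
      linarith
  -- The output is wrong for all `k` but one.
  have hgsum : ∑ k, ∫ ω, g k ω ∂P.coinsLaw = d - 1 := by
    rw [← integral_finsetSum _ fun k _ => hgi k]
    have : ∀ ω, ∑ k, g k ω = d - 1 := fun ω => by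
      have h : ∀ k, g k ω = 1 - if P.referee.output (P.run σ N ω).1 = k then 1 else 0 := by
        intro k
        simp only [hg, Set.indicator_apply, Set.mem_compl_iff, Set.mem_singleton_iff,
          Pi.one_apply]
        split_ifs <;> simp
      simp [h]
    simp [this]
  have hasked : ∑ i, ∫ ω, (P.askedHistories N i).indicator 1 (P.transcript σ N ω) ∂P.coinsLaw ≤
      (N : ℝ) := by
    have hai : ∀ i, Integrable (fun ω =>
        (P.askedHistories N i).indicator (1 : (ℕ → P.referee.State) → ℝ) (P.transcript σ N ω))
        P.coinsLaw := fun i => by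
      refine Integrable.of_bound ((measurable_one.indicator
        (P.measurableSet_askedHistories N i)).comp
          (P.measurable_transcript σ N)).aestronglyMeasurable 1
        (Filter.Eventually.of_forall fun ω => ?_)
      by_cases h : P.transcript σ N ω ∈ P.askedHistories N i <;> simp [h]
    rw [← integral_finsetSum _ fun i _ => hai i]
    refine (integral_mono (integrable_finsetSum _ fun i _ => hai i) (integrable_const (N : ℝ))
      fun ω => P.sum_indicator_askedHistories_le N _).trans_eq (by simp)
  have hbsum : ∑ k, ∑ i, ∫ ω, |b i k ω| ∂P.coinsLaw ≤ Real.exp ε * √d * N := by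
    rw [Finset.sum_comm]
    refine (Finset.sum_le_sum fun i _ =>
      P.sum_integral_abs_posterior_le hP σ N i (hbm i) (hrep i)).trans ?_
    rw [← Finset.mul_sum]
    exact mul_le_mul_of_nonneg_left hasked (by positivity)
  have := Finset.sum_le_sum fun k (_ : k ∈ Finset.univ) => hone k
  rw [Finset.sum_sub_distrib, hgsum] at this
  linarith

lemma real_outcome (P : LocalProtocol (Fin d → Bool) Q M O n) (Y : Fin n → Fin d → Bool)
    {T : Set O} (hT : MeasurableSet T) :
    (P.outcome Y).real T = ∫ σ, ∫ s, T.indicator 1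
      (P.referee.output (P.step^[P.messages] (σ, s)).1)
        ∂(Measure.pi fun i => (P.agent i).start (Y i)) ∂P.referee.start := by
  have hm : Measurable fun s : P.Config => P.referee.output (P.step^[P.messages] s).1 :=
    P.referee.measurable_output.comp
      (measurable_fst.comp (P.measurable_step.iterate P.messages))
  have hi : Measurable fun s : P.Config =>
      T.indicator (1 : O → ℝ) (P.referee.output (P.step^[P.messages] s).1) :=
    (measurable_one.indicator hT).comp hm
  rw [← integral_prod (fun s : P.Config =>
    T.indicator (1 : O → ℝ) (P.referee.output (P.step^[P.messages] s).1)),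
    ← integral_indicator_one hT, outcome, integral_map hm.aemeasurable
      (measurable_one.indicator hT).aestronglyMeasurable]
  refine Integrable.of_bound hi.aestronglyMeasurable 1 (Filter.Eventually.of_forall fun s => ?_)
  by_cases h : P.referee.output (P.step^[P.messages] s).1 ∈ T <;> simp [h]

end LocalProtocol

/-! ### The hard distributions and the selection guarantee. -/

open scoped ENNReal

/-- The uniform distribution on the points of the cube whose `k`-th bit is set. -/
def cubeTilt {d : ℕ} (k : Fin d) : Measure (Fin d → Bool) :=
  ∑ x, ENNReal.ofReal (((2 : ℝ) ^ d)⁻¹ * (1 + cubeSign k x)) • Measure.dirac x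

lemma cubeTilt_real {d : ℕ} (k : Fin d) (S : Set (Fin d → Bool)) :
    (cubeTilt k).real S = ∑ x, ((2 : ℝ) ^ d)⁻¹ * (1 + cubeSign k x) * S.indicator 1 x := by
  rw [Measure.real, cubeTilt, Measure.finsetSum_apply, ENNReal.toReal_sum]
  · refine Finset.sum_congr rfl fun x _ => ?_
    rw [Measure.smul_apply, Measure.dirac_apply' _ (Set.toFinite S).measurableSet, smul_eq_mul,
      ENNReal.toReal_mul, ENNReal.toReal_ofReal
        (mul_nonneg (by positivity) (one_add_cubeSign_nonneg k x))]
    by_cases h : x ∈ S <;> simp [h]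
  · intro x _
    rw [Measure.smul_apply, smul_eq_mul]
    exact ENNReal.mul_ne_top ENNReal.ofReal_ne_top (measure_ne_top _ _)

lemma cubeTilt_real_singleton {d : ℕ} (k : Fin d) (x : Fin d → Bool) :
    (cubeTilt k).real {x} = ((2 : ℝ) ^ d)⁻¹ * (1 + cubeSign k x) := by
  rw [cubeTilt_real, Finset.sum_eq_single x]
  · simp
  · intro y _ hy
    simp [hy]
  · simp

instance {d : ℕ} (k : Fin d) : IsProbabilityMeasure (cubeTilt k) := by
  rw [isProbabilityMeasure_iff_real, cubeTilt_real]
  simp [← Finset.mul_sum, Finset.sum_add_distrib, sum_cubeSign]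

lemma coordMean_cubeTilt {d : ℕ} (k j : Fin d) :
    coordMean (cubeTilt k) j = 1 - 1 / 2 * ({k}ᶜ : Set (Fin d)).indicator 1 j := by
  have h : ∀ x : Fin d → Bool, {y : Fin d → Bool | y j = true}.indicator (1 : (Fin d → Bool) → ℝ) x =
      (1 + cubeSign j x) / 2 := by
    intro x
    by_cases hx : x j = true <;> simp [cubeSign, hx]
  have h' : ∀ x : Fin d → Bool, ((2 : ℝ) ^ d)⁻¹ * (1 + cubeSign k x) *
      ((1 + cubeSign j x) / 2) = ((2 : ℝ) ^ d)⁻¹ / 2 *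
        (1 + cubeSign k x + cubeSign j x + cubeSign k x * cubeSign j x) := fun x => by ring
  rw [coordMean, cubeTilt_real]
  simp_rw [h, h']
  rw [← Finset.mul_sum]
  simp only [Finset.sum_add_distrib, sum_cubeSign, sum_cubeSign_mul]
  by_cases hkj : k = j
  · subst hkj
    simp
    field_simp
    norm_num
  · simp [hkj, Ne.symm hkj]
    field_simp
    norm_num

namespace LocalProtocol

variable {d n : ℕ} {Q M : Type u} [MeasurableSpace Q] [MeasurableSpace M]

/-- The probability that the output is not `k`, if the referee starts in `σ` and the inputs
are `Y`. -/
def wrongProb (P : LocalProtocol (Fin d → Bool) Q M (Fin d) n) (k : Fin d)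
    (Y : Fin n → Fin d → Bool) (σ : P.referee.State) : ℝ :=
  ∫ s, ({k}ᶜ : Set (Fin d)).indicator 1 (P.referee.output (P.step^[P.messages] (σ, s)).1)
    ∂(Measure.pi fun i => (P.agent i).start (Y i))

lemma integrable_wrongProb (P : LocalProtocol (Fin d → Bool) Q M (Fin d) n) (k : Fin d)
    (Y : Fin n → Fin d → Bool) : Integrable (P.wrongProb k Y) P.referee.start := by
  have hi : Measurable fun s : P.Config => ({k}ᶜ : Set (Fin d)).indicator (1 : Fin d → ℝ)
      (P.referee.output (P.step^[P.messages] s).1) :=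
    (measurable_of_finite (({k}ᶜ : Set (Fin d)).indicator (1 : Fin d → ℝ))).comp
      (P.referee.measurable_output.comp
        (measurable_fst.comp (P.measurable_step.iterate P.messages)))
  have : Integrable (fun s : P.Config => ({k}ᶜ : Set (Fin d)).indicator (1 : Fin d → ℝ)
      (P.referee.output (P.step^[P.messages] s).1))
      (P.referee.start.prod (Measure.pi fun i => (P.agent i).start (Y i))) := by
    refine Integrable.of_bound hi.aestronglyMeasurable 1 (Filter.Eventually.of_forall fun s => ?_)
    by_cases h : P.referee.output (P.step^[P.messages] s).1 = k <;> simp [h]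
  exact this.integral_prod_left

/-- Change of measure: the product of the `1 + cubeSign k` is the density of independent `cubeTilt
k` inputs with respect to uniform ones. -/
lemma integral_coinsLaw_wrong (P : LocalProtocol (Fin d → Bool) Q M (Fin d) n) (k : Fin d)
    (σ : P.referee.State) :
    ∫ ω, ({k}ᶜ : Set (Fin d)).indicator 1 (P.referee.output (P.run σ P.messages ω).1) *
        ∏ i, (1 + cubeSign k (ω i).1) ∂P.coinsLaw =
      ∑ Y : Fin n → Fin d → Bool,
        (∏ i, (((2 : ℝ) ^ d)⁻¹ * (1 + cubeSign k (Y i)))) * P.wrongProb k Y σ := by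
  rw [P.integral_coinsLaw (C := 1 * 2 ^ n)]
  · refine Finset.sum_congr rfl fun Y _ => ?_
    simp only [integral_mul_const, Finset.prod_mul_distrib, Finset.prod_const, Finset.card_univ,
      Fintype.card_fin, wrongProb, run]
    ring
  · refine Measurable.mul ?_ (Finset.measurable_fun_prod _ fun i _ => measurable_const.add ?_)
    · exact (measurable_of_finite (({k}ᶜ : Set (Fin d)).indicator (1 : Fin d → ℝ))).comp
        (P.referee.measurable_output.comp (measurable_fst.comp (P.measurable_run σ P.messages)))
    · exact (measurable_of_finite (cubeSign k)).comp
        (measurable_fst.comp (measurable_pi_apply i))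
  · intro ω
    rw [abs_mul, Finset.abs_prod]
    gcongr
    · by_cases h : P.referee.output (P.run σ P.messages ω).1 = k <;> simp [h]
    · refine (Finset.prod_le_prod (fun _ _ => abs_nonneg _) fun i _ =>
        (abs_add_le 1 _).trans (?_ : _ ≤ (2 : ℝ))).trans_eq (by simp)
      rw [abs_cubeSign, abs_one]
      norm_num

lemma integral_outcome_wrong (P : LocalProtocol (Fin d → Bool) Q M (Fin d) n) (k : Fin d) :
    ∫ Y, (P.outcome Y).real {k}ᶜ ∂(Measure.pi fun _ => cubeTilt k) =
      ∑ Y : Fin n → Fin d → Bool, (∏ i, (((2 : ℝ) ^ d)⁻¹ * (1 + cubeSign k (Y i)))) *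
        ∫ σ, P.wrongProb k Y σ ∂P.referee.start := by
  rw [integral_fintype .of_finite]
  refine Finset.sum_congr rfl fun Y _ => ?_
  rw [P.real_outcome Y (Set.toFinite _).measurableSet, Measure.real, Measure.pi_singleton,
    ENNReal.toReal_prod, smul_eq_mul]
  congr 1
  exact Finset.prod_congr rfl fun i _ => cubeTilt_real_singleton k (Y i)

/-- Under `cubeTilt k` each wrong output costs exactly 1/2 in the mean. -/
lemma SolvesSelection.integral_wrong_le {P : LocalProtocol (Fin d → Bool) Q M (Fin d) n} {α : ℝ}
    (hP : P.SolvesSelection α) (k : Fin d) :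
    ∫ Y, (P.outcome Y).real {k}ᶜ ∂(Measure.pi fun _ => cubeTilt k) ≤ 2 * α := by
  have h := hP (cubeTilt k) inferInstance k
  have hin : ∀ Y, ∫ j, coordMean (cubeTilt k) j ∂(P.outcome Y) =
      1 - 1 / 2 * (P.outcome Y).real {k}ᶜ := by
    intro Y
    simp_rw [coordMean_cubeTilt]
    rw [integral_sub (integrable_const _) .of_finite, integral_const_mul,
      integral_indicator_one (Set.toFinite _).measurableSet]
    simp
  simp_rw [hin] at h
  rw [integral_sub (integrable_const _) .of_finite, integral_const_mul, coordMean_cubeTilt] at h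
  simp at h
  linarith

/-- The bound on the number of messages that the proof gives is of order `√d`. -/
theorem le_messages_of_solvesSelection (P : LocalProtocol (Fin d → Bool) Q M (Fin d) n)
    {ε α : ℝ} (hdp : P.IsDP ε 0) (hsel : P.SolvesSelection α) :
    d - 1 - 2 * α * d ≤ Real.exp ε * √d * P.messages := by
  have hint : ∀ k, Integrable (fun σ => ∑ Y : Fin n → Fin d → Bool,
      (∏ i, (((2 : ℝ) ^ d)⁻¹ * (1 + cubeSign k (Y i)))) * P.wrongProb k Y σ)
      P.referee.start := fun k =>
    integrable_finsetSum _ fun Y _ => (P.integrable_wrongProb k Y).const_mul _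
  have hk : ∀ k, ∫ σ, ∑ Y : Fin n → Fin d → Bool,
      (∏ i, (((2 : ℝ) ^ d)⁻¹ * (1 + cubeSign k (Y i)))) * P.wrongProb k Y σ
        ∂P.referee.start ≤ 2 * α := by
    intro k
    refine le_of_eq_of_le ?_ (hsel.integral_wrong_le k)
    rw [P.integral_outcome_wrong k,
      integral_finsetSum _ fun Y _ => (P.integrable_wrongProb k Y).const_mul _]
    simp_rw [integral_const_mul]
  have hlow : (d : ℝ) - 1 - Real.exp ε * √d * P.messages ≤
      ∫ σ, ∑ k, ∑ Y : Fin n → Fin d → Bool,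
        (∏ i, (((2 : ℝ) ^ d)⁻¹ * (1 + cubeSign k (Y i)))) * P.wrongProb k Y σ
          ∂P.referee.start := by
    -- The bound holds for every initial state of the referee, hence on average over its coins.
    have h := integral_mono (integrable_const _) (integrable_finsetSum Finset.univ fun k _ => hint k)
      fun σ => (P.le_sum_integral_wrong hdp σ).trans_eq
        (Finset.sum_congr rfl fun k _ => P.integral_coinsLaw_wrong k σ)
    simpa using h
  rw [integral_finsetSum _ fun k _ => hint k] at hlow
  have hup := Finset.sum_le_sum fun k (_ : k ∈ (Finset.univ : Finset (Fin d))) => hk k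
  simp only [Finset.sum_const, Finset.card_univ, Fintype.card_fin, nsmul_eq_mul] at hup
  linarith

end LocalProtocol

end

theorem mainTheorem7 :
    ∃ c : ℝ, 0 < c ∧
      ∀ (d : ℕ), 2 ≤ d → ∀ (n : ℕ) (Q M : Type u) [MeasurableSpace Q] [MeasurableSpace M]
        (P : LocalProtocol (Fin d → Bool) Q M (Fin d) n),
        P.IsDP 1 0 → P.SolvesSelection (1 / 10) →
          c * (d : ℝ) ^ (1 / 3 : ℝ) ≤ (P.messages : ℝ) := by
  refine ⟨1 / 10, by norm_num, fun d hd n Q M _ _ P hdp hsel => ?_⟩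
  have h := P.le_messages_of_solvesSelection hdp hsel
  have hd2 : (2 : ℝ) ≤ d := by exact_mod_cast hd
  have hpow : (d : ℝ) ^ (1 / 3 : ℝ) ≤ √d := by
    rw [Real.sqrt_eq_rpow]
    exact Real.rpow_le_rpow_of_exponent_le (by linarith) (by norm_num)
  have hsq : √(d : ℝ) * √d = d := Real.mul_self_sqrt (by linarith)
  have hpos : 0 < √(d : ℝ) := Real.sqrt_pos.2 (by linarith)
  have he : Real.exp 1 ≤ 3 := Real.exp_one_lt_d9.le.trans (by norm_num)
  have hm : (0 : ℝ) ≤ P.messages := Nat.cast_nonneg _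
  have h1 : Real.exp 1 * √d * P.messages ≤ 3 * √d * P.messages := by gcongr
  -- With `α = 1/10` the left side of `h` is `4d/5 - 1`, which is at least `3d/10` since `d ≥ 2`.
  -- Together with `e ≤ 3` this gives the constant 1/10.
  have h2 : √(d : ℝ) * (3 / 10 * √d) ≤ √d * (3 * P.messages) := by nlinarith
  have h3 := le_of_mul_le_mul_left h2 hpos
  linarith
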